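/- Let $G$ be a finite simple graph of maximum degree $\Delta$ that is outerplanar, i.e. $G$ has an embedding in the plane in which every vertex lies on the boundary of the unbounded face. Let $G^2$ be the graph on $V(G)$ in which two distinct vertices are adjacent if and only if their distance in $G$ is at most $2$. For a finite graph $H$ let $\mathrm{ind}(H)$, the inductiveness (degeneracy) of $H$, be the maximum of the minimum degree $\delta(H')$ over all induced subgraphs $H'$ of $H$. If $\Delta \ge 5$, then $\mathrm{ind}(G^2) \le \Delta + 1$. If moreover $\Delta \ge 7$, then $\mathrm{ind}(G^2) = \Delta$. -/

import Mathlib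

namespace SimpleGraph

/-- `A` is a simple arc (homeomorphic image of a closed interval) in the Euclidean plane with
the two end points `x` and `y`. -/
def IsPlaneArc (A : Set (EuclideanSpace ℝ (Fin 2))) (x y : EuclideanSpace ℝ (Fin 2)) : Prop :=
  ∃ γ : _root_.Path x y, Function.Injective γ ∧ Set.range γ = A

/-- An embedding of the graph `G` in the Euclidean plane: the vertices are distinct points, every
edge is a simple arc joining its two end vertices, no arc passes through a further vertex, and two
distinct arcs meet in common end vertices only. -/
structure PlaneEmbedding {V : Type*} (G : SimpleGraph V) where
  /-- the point that represents a vertex -/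
  point : V → EuclideanSpace ℝ (Fin 2)
  /-- the arc that represents an edge -/
  arc : G.edgeSet → Set (EuclideanSpace ℝ (Fin 2))
  point_injective : Function.Injective point
  isPlaneArc_arc : ∀ (u v : V) (h : G.Adj u v),
    IsPlaneArc (arc ⟨s(u, v), (G.mem_edgeSet).2 h⟩) (point u) (point v)
  mem_of_point_mem_arc : ∀ (w : V) (e : G.edgeSet), point w ∈ arc e → w ∈ (e : Sym2 V)
  arc_inter_arc : ∀ e e' : G.edgeSet, e ≠ e' → ∀ p ∈ arc e ∩ arc e',
    ∃ w : V, w ∈ (e : Sym2 V) ∧ w ∈ (e' : Sym2 V) ∧ point w = p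

/-- The set of all points of the plane used by the embedding. -/
def PlaneEmbedding.carrier {V : Type*} {G : SimpleGraph V} (D : PlaneEmbedding G) :
    Set (EuclideanSpace ℝ (Fin 2)) :=
  Set.range D.point ∪ ⋃ e : G.edgeSet, D.arc e

/-- A face of the embedding: a connected component of the complement of the drawing. -/
def PlaneEmbedding.IsFace {V : Type*} {G : SimpleGraph V} (D : PlaneEmbedding G)
    (F : Set (EuclideanSpace ℝ (Fin 2))) : Prop :=
  ∃ x ∈ D.carrierᶜ, F = connectedComponentIn D.carrierᶜ x

/-- A graph is outerplanar if it has an embedding in the plane for which every vertex lies on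
the boundary of the unbounded face. -/
def IsOuterplanar {V : Type*} (G : SimpleGraph V) : Prop :=
  ∃ (D : PlaneEmbedding G) (F : Set (EuclideanSpace ℝ (Fin 2))),
    D.IsFace F ∧ ¬ Bornology.IsBounded F ∧ ∀ v : V, D.point v ∈ frontier F

/-- The square of `G`: two distinct vertices are adjacent if they are adjacent in `G` or have a
common neighbor in `G`. -/
def square {V : Type*} (G : SimpleGraph V) : SimpleGraph V where
  Adj u v := u ≠ v ∧ (G.Adj u v ∨ ∃ w, G.Adj u w ∧ G.Adj v w)
  symm := ⟨fun _ _ h => ⟨h.1.symm, h.2.imp (fun h => h.symm) fun ⟨w, h₁, h₂⟩ => ⟨w, h₂, h₁⟩⟩⟩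
  loopless := ⟨fun _ h => h.1 rfl⟩

open Classical in
/-- The inductiveness (degeneracy) of a finite graph: the maximum, over all induced subgraphs,
of the minimum degree (the empty vertex set contributes `0`). -/
noncomputable def inductiveness {V : Type*} [Fintype V] (G : SimpleGraph V) : ℕ :=
  (Finset.univ : Finset (Finset V)).sup fun s => (G.induce (s : Set V)).minDegree

end SimpleGraph

/-! Outerplanarity is first turned into combinatorics. Coning the drawing from a point of the face
that touches all vertices turns a `K₄` minor into a drawing of `K₅`, and a `K₂,₃` minor into one of
`K₃,₃`. Both are excluded by van Kampen's parity argument, carried out with continuous logarithms. A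
graph without these two minors has a vertex `v` with at most two neighbors. Contract an edge at `v`,
place the smaller graph on a line by induction, and reinsert `v` next to the edge between its
neighbors; if both sides are blocked, there is a `K₂,₃` minor. Hence the vertices lie on a line with
noncrossing edges (`exists_isNoncrossing`).

The upper bounds follow from one claim about such a graph: if all degrees are at most `k`, where `k
≥ 7`, or `k ≥ 6` and all degrees are below `k`, then some vertex with one or two neighbors has at
most `k` neighbors in the square. Otherwise (`IsCritical`) every edge `ab` is shown, by induction on
the interval it spans, to be empty below, to span a single triangle, or to be heavy: few neighbors
inside, but end degrees near `k`. The chain of outermost edges below `ab` has inner vertices whose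
whole degree is visible inside the chain; this excludes heavy edges in it and bounds it to three
edges (`config`). The edge from the first nonisolated vertex to its last neighbor then gives a
contradiction.

For degeneracy, contracting an edge at the vertex found keeps the hypotheses and every square
adjacency among the other vertices, so the claim passes to any vertex subset. Use `k = Δ + 1` for
the first bound and `k = Δ` for the second. The lower bound holds because closed neighborhoods are
cliques in the square. -/

namespace PlaneTopology

/-! ### Nonplanarity of `K₅` and `K₃,₃` by winding parity -/

/-- A continuous nowhere vanishing complex function on a simply connected space has a continuous
logarithm. -/
theorem exists_continuous_log {X : Type*} [TopologicalSpace X] [SimplyConnectedSpace X]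
    [LocallyPathConnectedSpace X] {f : X → ℂ} (hf : Continuous f) (h0 : ∀ x, f x ≠ 0) :
    ∃ L : X → ℂ, Continuous L ∧ ∀ x, Complex.exp (L x) = f x := by
  obtain ⟨x₀⟩ : Nonempty X := inferInstance
  obtain ⟨F, ⟨-, hF⟩, -⟩ := Complex.isCoveringMapOn_exp.existsUnique_continuousMap_lifts
    ⟨f, hf⟩ (a₀ := x₀) (Complex.exp_log (h0 x₀)) h0
  exact ⟨F, F.continuous, fun x => congrFun hF x⟩

/-- Both functions lift the same map through the covering `exp`; shifted to agree at `b`, they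
coincide everywhere. -/
theorem log_sub_log_unique {L L' : ℝ → ℂ} (hL : Continuous L) (hL' : Continuous L')
    (h : ∀ x, Complex.exp (L x) = Complex.exp (L' x)) (a b : ℝ) : L a - L b = L' a - L' b := by
  have hu := Complex.isCoveringMapOn_exp.existsUnique_continuousMap_lifts
    ⟨fun x => Complex.exp (L x), by fun_prop⟩ (a₀ := b) (e₀ := L b) rfl
    (fun x => Complex.exp_ne_zero _)
  have e : Complex.exp (L b - L' b) = 1 := by
    rw [Complex.exp_sub, h b, div_self (Complex.exp_ne_zero _)]
  have := hu.unique (y₁ := ⟨L, hL⟩) (y₂ := ⟨fun x => L' x + (L b - L' b), by fun_prop⟩)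
    ⟨rfl, rfl⟩ ⟨by simp, by ext x; simp [Complex.exp_add, e, h]⟩
  have := congrFun (congrArg DFunLike.coe this) a
  simp only [ContinuousMap.coe_mk] at this
  rw [this]; ring

/-- The change of a continuous logarithm of `f` between `0` and `1`. -/
noncomputable def logChange (f : ℝ → ℂ) (hf : Continuous f) (h0 : ∀ x, f x ≠ 0) : ℂ :=
  (exists_continuous_log hf h0).choose 1 - (exists_continuous_log hf h0).choose 0

theorem logChange_eq {f : ℝ → ℂ} (hf : Continuous f) (h0 : ∀ x, f x ≠ 0) {L : ℝ → ℂ}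
    (hL : Continuous L) (h : ∀ x, Complex.exp (L x) = f x) : logChange f hf h0 = L 1 - L 0 :=
  log_sub_log_unique (exists_continuous_log hf h0).choose_spec.1 hL
    (fun x => by rw [(exists_continuous_log hf h0).choose_spec.2, h]) 1 0

theorem exists_int_logChange {f : ℝ → ℂ} (hf : Continuous f) (h0 : ∀ x, f x ≠ 0) {a b : ℂ}
    (ha : Complex.exp a = f 0) (hb : Complex.exp b = f 1) :
    ∃ n : ℤ, logChange f hf h0 = b - a + n * (2 * Real.pi * Complex.I) := by
  obtain ⟨L, hL, h⟩ := exists_continuous_log hf h0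
  rw [logChange_eq hf h0 hL h]
  rw [← h] at ha hb
  obtain ⟨m, hm⟩ := Complex.exp_eq_exp_iff_exists_int.1 ha
  obtain ⟨k, hk⟩ := Complex.exp_eq_exp_iff_exists_int.1 hb
  refine ⟨m - k, ?_⟩
  rw [hm, hk]; push_cast; ring

/-- The logarithm of `g t - f s` changes by zero around the boundary of the unit square. -/
theorem logChange_square {f g : ℝ → ℂ} (hf : Continuous f) (hg : Continuous g)
    (h : ∀ s t, f s ≠ g t) :
    logChange (fun t => g t - f 0) (by fun_prop) (fun t => sub_ne_zero.2 (h 0 t).symm) +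
      logChange (fun s => f s - g 1) (by fun_prop) (fun s => sub_ne_zero.2 (h s 1)) -
      logChange (fun t => g t - f 1) (by fun_prop) (fun t => sub_ne_zero.2 (h 1 t).symm) -
      logChange (fun s => f s - g 0) (by fun_prop) (fun s => sub_ne_zero.2 (h s 0)) = 0 := by
  obtain ⟨L, hL, hL'⟩ := exists_continuous_log (X := ℝ × ℝ) (f := fun p => g p.2 - f p.1)
    (by fun_prop) (fun p => sub_ne_zero.2 (h p.1 p.2).symm)
  rw [logChange_eq (L := fun t => L (0, t)) _ _ (by fun_prop) (fun t => hL' _),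
    logChange_eq (L := fun t => L (1, t)) _ _ (by fun_prop) (fun t => hL' _),
    logChange_eq (L := fun s => L (s, 1) + Real.pi * Complex.I) _ _ (by fun_prop)
      (fun s => by rw [Complex.exp_add, hL', Complex.exp_pi_mul_I]; ring),
    logChange_eq (L := fun s => L (s, 0) + Real.pi * Complex.I) _ _ (by fun_prop)
      (fun s => by rw [Complex.exp_add, hL', Complex.exp_pi_mul_I]; ring)]
  ring

/-- The sign that records the order of two indices. -/
def orderSign {N : ℕ} (a b : Fin N) : ℤ := if a < b then -1 else 1

/-- The parity equations of van Kampen for a drawing of a graph in the plane in which edges without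
common end vertices do not meet. -/
theorem exists_vanKampen_cochain {N : ℕ} (P : Fin N → ℂ) (E : Fin N → Fin N → Prop)
    (S : Fin N → Fin N → Set ℂ) (hj : ∀ u v, E u v → JoinedIn (S u v) (P u) (P v))
    (hd : ∀ u v w x, E u v → E w x → u ≠ w → u ≠ x → v ≠ w → v ≠ x →
      Disjoint (S u v) (S w x)) :
    ∃ n : Fin N → Fin N → Fin N → ℤ, ∀ u v w x, E u v → E w x → u ≠ w → u ≠ x → v ≠ w → v ≠ x →
      2 * (n u w x + n x u v - n v w x - n w u v) +
        orderSign u x + orderSign w u + orderSign x v + orderSign v w = 0 := by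
  classical
  have hγ : ∀ u v, ∃ γ : ℝ → ℂ, Continuous γ ∧
      (E u v → γ 0 = P u ∧ γ 1 = P v ∧ ∀ t, γ t ∈ S u v) := by
    intro u v
    by_cases h : E u v
    · refine ⟨(hj u v h).somePath.extend, Path.continuous_extend _, fun _ => ⟨by simp, by simp, ?_⟩⟩
      intro t
      have := Path.extend_range (hj u v h).somePath
      obtain ⟨s, hs⟩ : (hj u v h).somePath.extend t ∈ Set.range (hj u v h).somePath := by
        rw [← this]; exact ⟨t, rfl⟩
      rw [← hs]; exact (hj u v h).somePath_mem s
    · exact ⟨fun _ => 0, by fun_prop, fun h' => absurd h' h⟩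
  choose γ hγc hγ using hγ
  -- A fixed logarithm of `P b - P a`, chosen so that swapping `a` and `b` costs exactly a half
  -- turn, with sign given by the order of the indices.
  set θ : Fin N → Fin N → ℂ := fun a b =>
    if a < b then Complex.log (P b - P a) else Complex.log (P a - P b) + Real.pi * Complex.I with hθ
  have θ_exp : ∀ a b, P b ≠ P a → Complex.exp (θ a b) = P b - P a := by
    intro a b hab
    by_cases h : a < b
    · simp only [hθ, h, if_true]; exact Complex.exp_log (sub_ne_zero.2 hab)
    · simp only [hθ, h, if_false]
      rw [Complex.exp_add, Complex.exp_log (sub_ne_zero.2 hab.symm), Complex.exp_pi_mul_I]; ring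
  have θ_sub : ∀ a b, a ≠ b → θ a b - θ b a = orderSign a b * (Real.pi * Complex.I) := by
    intro a b hab
    rcases lt_or_gt_of_ne hab with h | h
    · simp [hθ, orderSign, h, not_lt_of_gt h]
    · simp [hθ, orderSign, h, not_lt_of_gt h]
  -- The integer counts the full turns of the edge `wx` around `P p`, relative to the fixed
  -- logarithms.
  have hn : ∀ p w x, ∃ m : ℤ, ∀ h0 : ∀ t, γ w x t - P p ≠ 0, E w x →
      logChange (fun t => γ w x t - P p) (by fun_prop) h0 =
        θ p x - θ p w + m * (2 * Real.pi * Complex.I) := by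
    intro p w x
    by_cases h : (∀ t, γ w x t - P p ≠ 0) ∧ E w x
    · obtain ⟨h0, hE⟩ := h
      have h1 := (hγ w x hE).1
      have h2 := (hγ w x hE).2.1
      obtain ⟨m, hm⟩ := exists_int_logChange (f := fun t => γ w x t - P p) (by fun_prop) h0
        (a := θ p w) (b := θ p x)
        (by rw [θ_exp, h1]; rw [← h1]; exact sub_ne_zero.1 (h0 0))
        (by rw [θ_exp, h2]; rw [← h2]; exact sub_ne_zero.1 (h0 1))
      exact ⟨m, fun _ _ => hm⟩
    · exact ⟨0, fun h0 hE => absurd ⟨h0, hE⟩ h⟩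
  choose n hn using hn
  refine ⟨n, fun u v w x huv hwx huw hux hvw hvx => ?_⟩
  have hne : ∀ s t, γ u v s ≠ γ w x t := fun s t =>
    Set.disjoint_iff_forall_ne.1 (hd u v w x huv hwx huw hux hvw hvx) ((hγ u v huv).2.2 s)
      ((hγ w x hwx).2.2 t)
  have key := logChange_square (hγc u v) (hγc w x) hne
  simp only [(hγ u v huv).1, (hγ u v huv).2.1, (hγ w x hwx).1, (hγ w x hwx).2.1] at key
  rw [hn u w x _ hwx, hn x u v _ huv, hn v w x _ hwx, hn w u v _ huv] at key
  have e : ((2 * (n u w x + n x u v - n v w x - n w u v) +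
        orderSign u x + orderSign w u + orderSign x v + orderSign v w : ℤ) : ℂ) *
        (Real.pi * Complex.I) = 0 := by
    push_cast
    linear_combination key - θ_sub u x hux - θ_sub w u huw.symm - θ_sub x v hvx.symm - θ_sub v w hvw
  have hpi : (Real.pi * Complex.I : ℂ) ≠ 0 := by simp [Real.pi_ne_zero]
  exact_mod_cast (mul_eq_zero.1 e).resolve_right hpi

/-- `K₅` has no drawing in the plane in which edges without common end vertices do not meet. -/
theorem not_drawing_K5 (P : Fin 5 → ℂ) (S : Fin 5 → Fin 5 → Set ℂ)
    (hj : ∀ u v, u < v → JoinedIn (S u v) (P u) (P v))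
    (hd : ∀ u v w x, u < v → w < x → u ≠ w → u ≠ x → v ≠ w → v ≠ x →
      Disjoint (S u v) (S w x)) : False := by
  obtain ⟨n, hn⟩ := exists_vanKampen_cochain P (· < ·) S hj hd
  have h1 := hn 0 1 2 3 (by decide) (by decide) (by decide) (by decide) (by decide) (by decide)
  have h2 := hn 0 1 2 4 (by decide) (by decide) (by decide) (by decide) (by decide) (by decide)
  have h3 := hn 0 1 3 4 (by decide) (by decide) (by decide) (by decide) (by decide) (by decide)
  have h4 := hn 0 2 1 3 (by decide) (by decide) (by decide) (by decide) (by decide) (by decide)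
  have h5 := hn 0 2 1 4 (by decide) (by decide) (by decide) (by decide) (by decide) (by decide)
  have h6 := hn 0 2 3 4 (by decide) (by decide) (by decide) (by decide) (by decide) (by decide)
  have h7 := hn 0 3 1 2 (by decide) (by decide) (by decide) (by decide) (by decide) (by decide)
  have h8 := hn 0 3 1 4 (by decide) (by decide) (by decide) (by decide) (by decide) (by decide)
  have h9 := hn 0 3 2 4 (by decide) (by decide) (by decide) (by decide) (by decide) (by decide)
  have h10 := hn 0 4 1 2 (by decide) (by decide) (by decide) (by decide) (by decide) (by decide)
  have h11 := hn 0 4 1 3 (by decide) (by decide) (by decide) (by decide) (by decide) (by decide)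
  have h12 := hn 0 4 2 3 (by decide) (by decide) (by decide) (by decide) (by decide) (by decide)
  have h13 := hn 1 2 3 4 (by decide) (by decide) (by decide) (by decide) (by decide) (by decide)
  have h14 := hn 1 3 2 4 (by decide) (by decide) (by decide) (by decide) (by decide) (by decide)
  have h15 := hn 1 4 2 3 (by decide) (by decide) (by decide) (by decide) (by decide) (by decide)
  -- Each pair of vertex and disjoint edge occurs in exactly two of the 15 equations, so the
  -- unknowns enter the sum with coefficients divisible by 4. The order signs contribute 2 for each
  -- interleaved pair of edges and 0 otherwise: 10 in total, which is 2 modulo 4.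
  have h := congrArg₂ (· + ·) (congrArg₂ (· + ·) (congrArg₂ (· + ·) h1 h2)
    (congrArg₂ (· + ·) h3 h4)) (congrArg₂ (· + ·) (congrArg₂ (· + ·) (congrArg₂ (· + ·) h5 h6)
    (congrArg₂ (· + ·) h7 h8)) (congrArg₂ (· + ·) (congrArg₂ (· + ·) (congrArg₂ (· + ·) h9 h10)
    (congrArg₂ (· + ·) h11 h12)) (congrArg₂ (· + ·) (congrArg₂ (· + ·) h13 h14) h15)))
  simp [orderSign] at h
  omega

/-- The complete bipartite graph `K₃,₃` has no drawing in the plane in which edges without common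
end vertices do not meet. -/
theorem not_drawing_K33 (P : Fin 6 → ℂ) (S : Fin 6 → Fin 6 → Set ℂ)
    (hj : ∀ u v, u < 3 → 3 ≤ v → JoinedIn (S u v) (P u) (P v))
    (hd : ∀ u v w x, u < 3 → 3 ≤ v → w < 3 → 3 ≤ x → u ≠ w → v ≠ x →
      Disjoint (S u v) (S w x)) : False := by
  obtain ⟨n, hn⟩ := exists_vanKampen_cochain P (fun u v => u < 3 ∧ 3 ≤ v) S
    (fun u v h => hj u v h.1 h.2)
    (fun u v w x h h' huw _ _ hvx => hd u v w x h.1 h.2 h'.1 h'.2 huw hvx)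
  have hh : ∀ u v w x : Fin 6, (u < w ∧ w < 3 ∧ 3 ≤ v ∧ 3 ≤ x ∧ v ≠ x) →
      2 * (n u w x + n x u v - n v w x - n w u v) +
        orderSign u x + orderSign w u + orderSign x v + orderSign v w = 0 := by
    rintro u v w x ⟨h1, h2, h3, h4, h5⟩
    exact hn u v w x ⟨h1.trans h2, h3⟩ ⟨h2, h4⟩ h1.ne ((h1.trans h2).trans_le h4).ne
      (h2.trans_le h3).ne' h5
  have h1 := hh 0 3 1 4 (by decide)
  have h2 := hh 0 3 1 5 (by decide)
  have h3 := hh 0 4 1 3 (by decide)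
  have h4 := hh 0 4 1 5 (by decide)
  have h5 := hh 0 5 1 3 (by decide)
  have h6 := hh 0 5 1 4 (by decide)
  have h7 := hh 0 3 2 4 (by decide)
  have h8 := hh 0 3 2 5 (by decide)
  have h9 := hh 0 4 2 3 (by decide)
  have h10 := hh 0 4 2 5 (by decide)
  have h11 := hh 0 5 2 3 (by decide)
  have h12 := hh 0 5 2 4 (by decide)
  have h13 := hh 1 3 2 4 (by decide)
  have h14 := hh 1 3 2 5 (by decide)
  have h15 := hh 1 4 2 3 (by decide)
  have h16 := hh 1 4 2 5 (by decide)
  have h17 := hh 1 5 2 3 (by decide)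
  have h18 := hh 1 5 2 4 (by decide)
  -- As for `K₅`: the unknowns have coefficients divisible by 4, while 9 of the 18 pairs of edges
  -- interleave and contribute 18.
  have h := congrArg₂ (· + ·) (congrArg₂ (· + ·) (congrArg₂ (· + ·) (congrArg₂ (· + ·) h1 h2)
    (congrArg₂ (· + ·) h3 h4)) (congrArg₂ (· + ·) (congrArg₂ (· + ·) (congrArg₂ (· + ·) h5 h6)
    (congrArg₂ (· + ·) h7 h8)) (congrArg₂ (· + ·) (congrArg₂ (· + ·) (congrArg₂ (· + ·) h9 h10)
    (congrArg₂ (· + ·) h11 h12)) (congrArg₂ (· + ·) (congrArg₂ (· + ·) h13 h14) h15))))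
    (congrArg₂ (· + ·) (congrArg₂ (· + ·) h16 h17) h18)
  simp [orderSign] at h
  omega

end PlaneTopology

/-! ### Excluded minors of outerplanar graphs -/

namespace SimpleGraph

variable {V : Type*}

/-- A nonempty set of vertices which induces a connected subgraph. -/
def IsConnectedSet (G : SimpleGraph V) (X : Set V) : Prop :=
  X.Nonempty ∧ ∀ a ∈ X, ∀ b ∈ X, Relation.ReflTransGen (fun p q => G.Adj p q ∧ q ∈ X) a b

/-- The graph with vertex set `ι` and edges given by `r` is a minor of `G`. -/
def HasMinor {ι : Type*} (r : ι → ι → Prop) (G : SimpleGraph V) : Prop :=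
  ∃ X : ι → Set V, (∀ i, G.IsConnectedSet (X i)) ∧ (∀ i j, i ≠ j → Disjoint (X i) (X j)) ∧
    ∀ i j, r i j → ∃ a ∈ X i, ∃ b ∈ X j, G.Adj a b

/-- The complete graph on four vertices is a minor of `G`. -/
def HasK4Minor (G : SimpleGraph V) : Prop := HasMinor (fun i j : Fin 4 => i < j) G

/-- The complete bipartite graph with parts of sizes two and three is a minor of `G`. -/
def HasK23Minor (G : SimpleGraph V) : Prop := HasMinor (fun i j : Fin 5 => i < 2 ∧ 2 ≤ j) G

theorem IsConnectedSet.union {G : SimpleGraph V} {X Y : Set V} (hX : G.IsConnectedSet X)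
    (hY : G.IsConnectedSet Y) {a b : V} (ha : a ∈ X) (hb : b ∈ Y) (hab : G.Adj a b) :
    G.IsConnectedSet (X ∪ Y) := by
  have mX : ∀ {p q}, Relation.ReflTransGen (fun p q => G.Adj p q ∧ q ∈ X) p q →
      Relation.ReflTransGen (fun p q => G.Adj p q ∧ q ∈ X ∪ Y) p q :=
    fun h => Relation.ReflTransGen.mono (fun _ _ h => ⟨h.1, Or.inl h.2⟩) _ _ h
  have mY : ∀ {p q}, Relation.ReflTransGen (fun p q => G.Adj p q ∧ q ∈ Y) p q →
      Relation.ReflTransGen (fun p q => G.Adj p q ∧ q ∈ X ∪ Y) p q :=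
    fun h => Relation.ReflTransGen.mono (fun _ _ h => ⟨h.1, Or.inr h.2⟩) _ _ h
  refine ⟨⟨a, Or.inl ha⟩, ?_⟩
  rintro p (hp | hp) q (hq | hq)
  · exact mX (hX.2 p hp q hq)
  · exact ((mX (hX.2 p hp a ha)).tail ⟨hab, Or.inr hb⟩).trans (mY (hY.2 b hb q hq))
  · exact ((mY (hY.2 p hp b hb)).tail ⟨hab.symm, Or.inl ha⟩).trans (mX (hX.2 a ha q hq))
  · exact mY (hY.2 p hp q hq)

theorem isConnectedSet_singleton (G : SimpleGraph V) (v : V) : G.IsConnectedSet {v} := by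
  refine ⟨⟨v, rfl⟩, ?_⟩
  rintro a rfl b rfl
  exact .refl

namespace PlaneEmbedding

variable {G : SimpleGraph V} (D : PlaneEmbedding G)

/-- The part of the drawing which belongs to the subgraph induced by `X`. -/
def carrierOn (X : Set V) : Set (EuclideanSpace ℝ (Fin 2)) :=
  D.point '' X ∪ ⋃ e : G.edgeSet, ⋃ _ : ∀ w ∈ (e : Sym2 V), w ∈ X, D.arc e

theorem carrierOn_subset_carrier (X : Set V) : D.carrierOn X ⊆ D.carrier := by
  refine Set.union_subset_union (Set.image_subset_range _ _) ?_
  exact Set.iUnion_mono fun e => Set.iUnion_subset fun _ => subset_rfl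

theorem carrierOn_mono {X Y : Set V} (h : X ⊆ Y) : D.carrierOn X ⊆ D.carrierOn Y := by
  refine Set.union_subset_union (Set.image_mono h) ?_
  exact Set.iUnion_mono fun e => Set.iUnion_mono' fun h' => ⟨fun w hw => h (h' w hw), subset_rfl⟩

theorem carrierOn_univ : D.carrierOn Set.univ = D.carrier := by
  simp [carrierOn, carrier]

theorem isCompact_arc (e : G.edgeSet) : IsCompact (D.arc e) := by
  obtain ⟨e, he⟩ := e
  induction e using Sym2.ind with
  | _ u v =>
    obtain ⟨γ, -, h⟩ := D.isPlaneArc_arc u v he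
    rw [← h]
    exact isCompact_range γ.continuous

theorem isClosed_carrierOn [Finite V] (X : Set V) : IsClosed (D.carrierOn X) := by
  refine IsClosed.union (Set.toFinite _).isClosed ?_
  exact isClosed_iUnion_of_finite fun e => isClosed_iUnion_of_finite fun _ =>
    (D.isCompact_arc e).isClosed

theorem disjoint_carrierOn {X Y : Set V} (h : Disjoint X Y) :
    Disjoint (D.carrierOn X) (D.carrierOn Y) := by
  rw [Set.disjoint_left] at h ⊢
  have nonempty : ∀ e : Sym2 V, ∃ w, w ∈ e := fun e => by
    induction e using Sym2.ind with
    | _ u v => exact ⟨u, Sym2.mem_mk_left u v⟩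
  rintro p (⟨a, ha, rfl⟩ | hp) (⟨b, hb, hab⟩ | hq)
  · exact h ha (D.point_injective hab ▸ hb)
  · simp only [Set.mem_iUnion] at hq
    obtain ⟨e, he, hp⟩ := hq
    exact h ha (he a (D.mem_of_point_mem_arc a e hp))
  · simp only [Set.mem_iUnion] at hp
    obtain ⟨e, he, hp⟩ := hp
    exact h (he b (D.mem_of_point_mem_arc b e (hab ▸ hp))) hb
  · simp only [Set.mem_iUnion] at hp hq
    obtain ⟨e, he, hp⟩ := hp
    obtain ⟨e', he', hp'⟩ := hq
    by_cases hee : e = e'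
    · subst hee
      obtain ⟨w, hw⟩ := nonempty e
      exact h (he w hw) (he' w hw)
    · obtain ⟨w, hw, hw', -⟩ := D.arc_inter_arc e e' hee p ⟨hp, hp'⟩
      exact h (he w hw) (he' w hw')

theorem joinedIn_carrierOn_of_adj {X : Set V} {a b : V} (ha : a ∈ X) (hb : b ∈ X)
    (hab : G.Adj a b) : JoinedIn (D.carrierOn X) (D.point a) (D.point b) := by
  obtain ⟨γ, -, h⟩ := D.isPlaneArc_arc a b hab
  refine ⟨γ, fun t => Or.inr ?_⟩
  simp only [Set.mem_iUnion]
  refine ⟨⟨s(a, b), hab⟩, ?_, h.subset ⟨t, rfl⟩⟩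
  intro w hw
  rcases Sym2.mem_iff.1 hw with rfl | rfl <;> assumption

theorem joinedIn_carrierOn {X : Set V} (hX : G.IsConnectedSet X) {a b : V} (ha : a ∈ X)
    (hb : b ∈ X) : JoinedIn (D.carrierOn X) (D.point a) (D.point b) := by
  have h := hX.2 a ha b hb
  clear hb
  have : b ∈ X ∧ JoinedIn (D.carrierOn X) (D.point a) (D.point b) := by
    induction h with
    | refl => exact ⟨ha, JoinedIn.refl (Or.inl ⟨a, ha, rfl⟩)⟩
    | tail _ h ih => exact ⟨h.2, ih.2.trans (D.joinedIn_carrierOn_of_adj ih.1 h.2 h.1)⟩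
  exact this.2

end PlaneEmbedding

/-- A minor model in an outerplanar graph gives a drawing of the cone over the minor in which edges
without common end vertices do not meet. -/
theorem IsOuterplanar.exists_cone_drawing [Finite V] {G : SimpleGraph V} (hG : G.IsOuterplanar)
    {m : ℕ} {r : Fin m → Fin m → Prop} (hr : HasMinor r G) :
    ∃ (z : ℂ) (P : Fin m → ℂ) (A : Fin m → Set ℂ) (S : Fin m → Fin m → Set ℂ),
      (∀ j, JoinedIn (A j) z (P j)) ∧ (∀ i j, r i j → JoinedIn (S i j) (P i) (P j)) ∧
      (∀ j k l, j ≠ k → j ≠ l → Disjoint (A j) (S k l)) ∧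
      ∀ i j k l, i ≠ k → i ≠ l → j ≠ k → j ≠ l → Disjoint (S i j) (S k l) := by
  obtain ⟨D, F, ⟨x₀, hx₀, rfl⟩, -, hfr⟩ := hG
  obtain ⟨X, hX, hXd, hXr⟩ := hr
  choose x hx using fun i => (hX i).1
  set F := connectedComponentIn D.carrierᶜ x₀ with hF
  have hFo : IsOpen F := by
    have := D.isClosed_carrierOn Set.univ
    rw [D.carrierOn_univ] at this
    exact this.isOpen_compl.connectedComponentIn
  have hFp : IsPathConnected F := hFo.isConnected_iff_isPathConnected.1
    (isConnected_connectedComponentIn_iff.2 hx₀)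
  have hFd : ∀ Y, Disjoint F (D.carrierOn Y) := fun Y =>
    (Set.disjoint_left.2 fun p hp hq =>
      connectedComponentIn_subset _ _ hp (D.carrierOn_subset_carrier Y hq))
  -- A frontier point need not be reachable by a path inside the face, so each spoke ends in a small
  -- ball that avoids the other branch sets.
  have hball : ∀ j, ∃ ε > 0, Disjoint (Metric.ball (D.point (x j)) ε)
      (D.carrierOn (⋃ k ∈ {k | k ≠ j}, X k)) := by
    intro j
    have : D.point (x j) ∈ (D.carrierOn (⋃ k ∈ {k | k ≠ j}, X k))ᶜ := by
      have h : Disjoint (X j) (⋃ k ∈ {k | k ≠ j}, X k) := by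
        simp only [Set.disjoint_iUnion_right]
        exact fun k hk => hXd j k (Ne.symm hk)
      exact Set.disjoint_left.1 (D.disjoint_carrierOn h) (Or.inl ⟨_, hx j, rfl⟩)
    obtain ⟨ε, hε, h⟩ := Metric.isOpen_iff.1 (D.isClosed_carrierOn _).isOpen_compl _ this
    exact ⟨ε, hε, Set.disjoint_left.2 fun p hp hq => h hp hq⟩
  choose ε hε hball using hball
  set φ : EuclideanSpace ℝ (Fin 2) → ℂ := fun p => ⟨p 0, p 1⟩ with hφ
  have hφc : Continuous φ := by
    have : φ = fun p => ((p 0 : ℝ) : ℂ) + ((p 1 : ℝ) : ℂ) * Complex.I := by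
      funext p; exact (Complex.mk_eq_add_mul_I _ _)
    rw [this]; fun_prop
  have hφi : Function.Injective φ := by
    intro p q h
    have h0 := congrArg Complex.re h
    have h1 := congrArg Complex.im h
    ext i
    fin_cases i
    · exact h0
    · exact h1
  have himg : ∀ {S T : Set (EuclideanSpace ℝ (Fin 2))}, Disjoint S T → Disjoint (φ '' S) (φ '' T) :=
    fun h => (Set.disjoint_image_iff hφi).2 h
  have hjoin : ∀ {S : Set (EuclideanSpace ℝ (Fin 2))} {p q}, JoinedIn S p q →
      JoinedIn (φ '' S) (φ p) (φ q) := by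
    rintro S p q ⟨γ, h⟩
    exact ⟨γ.map hφc, fun t => ⟨_, h t, rfl⟩⟩
  -- Spokes may overlap, since they share the apex; only edges without common ends must be kept
  -- apart.
  refine ⟨φ x₀, fun i => φ (D.point (x i)), fun j => φ '' (F ∪ Metric.ball (D.point (x j)) (ε j)),
    fun i j => φ '' D.carrierOn (X i ∪ X j), ?_, ?_, ?_, ?_⟩
  · intro j
    have hcl : D.point (x j) ∈ closure F := frontier_subset_closure (hfr (x j))
    obtain ⟨y, hy, hyF⟩ := mem_closure_iff.1 hcl _ Metric.isOpen_ball (Metric.mem_ball_self (hε j))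
    refine hjoin (JoinedIn.trans (y := y) ?_ ?_)
    · exact (hFp.joinedIn x₀ (mem_connectedComponentIn hx₀) y hyF).mono Set.subset_union_left
    · refine JoinedIn.mono ?_ (Set.subset_union_right (t := Metric.ball (D.point (x j)) (ε j)))
      exact ((convex_ball (D.point (x j)) (ε j)).isPathConnected ⟨y, hy⟩).joinedIn _ hy _
        (Metric.mem_ball_self (hε j))
  · intro i j hij
    obtain ⟨a, ha, b, hb, hab⟩ := hXr i j hij
    exact hjoin (D.joinedIn_carrierOn ((hX i).union (hX j) ha hb hab) (Or.inl (hx i))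
      (Or.inr (hx j)))
  · intro j k l hk hl
    refine himg (Set.disjoint_union_left.2 ⟨hFd _, (hball j).mono_right (D.carrierOn_mono ?_)⟩)
    refine Set.union_subset ?_ ?_
    · exact Set.subset_biUnion_of_mem (u := X) (show k ∈ {k | k ≠ j} from hk.symm)
    · exact Set.subset_biUnion_of_mem (u := X) (show l ∈ {k | k ≠ j} from hl.symm)
  · intro i j k l h1 h2 h3 h4
    refine himg (D.disjoint_carrierOn ?_)
    simp only [Set.disjoint_union_left, Set.disjoint_union_right]
    exact ⟨⟨hXd _ _ h1, hXd _ _ h3⟩, hXd _ _ h2, hXd _ _ h4⟩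

/-- The sets of a drawing of a cone, with the apex as vertex `0`. -/
def coneDrawing {m : ℕ} (A : Fin m → Set ℂ) (S : Fin m → Fin m → Set ℂ) :
    Fin (m + 1) → Fin (m + 1) → Set ℂ :=
  fun u v => Fin.cases ∅ (fun j => Fin.cases (A j) (fun i => S i j) u) v

/-- The cone over `K₄` is `K₅`. -/
theorem IsOuterplanar.not_hasK4Minor [Finite V] {G : SimpleGraph V} (hG : G.IsOuterplanar) :
    ¬ G.HasK4Minor := by
  intro h
  obtain ⟨z, P, A, S, h1, h2, h3, h4⟩ := hG.exists_cone_drawing h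
  refine PlaneTopology.not_drawing_K5 (Fin.cons z P) (coneDrawing A S) ?_ ?_
  · intro u v huv
    obtain ⟨j, rfl⟩ := Fin.exists_succ_eq_of_ne_zero (Fin.ne_zero_of_lt huv)
    induction u using Fin.cases with
    | zero => simpa [coneDrawing] using h1 j
    | succ i => simpa [coneDrawing] using h2 i j (Fin.succ_lt_succ_iff.1 huv)
  · intro u v w x huv hwx huw hux hvw hvx
    obtain ⟨j, rfl⟩ := Fin.exists_succ_eq_of_ne_zero (Fin.ne_zero_of_lt huv)
    obtain ⟨l, rfl⟩ := Fin.exists_succ_eq_of_ne_zero (Fin.ne_zero_of_lt hwx)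
    induction u using Fin.cases with
    | zero =>
      obtain ⟨k, rfl⟩ := Fin.exists_succ_eq_of_ne_zero huw.symm
      simpa [coneDrawing] using h3 j k l (by simpa using hvw) (by simpa using hvx)
    | succ i =>
      induction w using Fin.cases with
      | zero =>
        simpa [coneDrawing] using (h3 l i j (by simpa using hux.symm) (by simpa using hvx.symm)).symm
      | succ k =>
        simpa [coneDrawing] using h4 i j k l (by simpa using huw) (by simpa using hux)
          (by simpa using hvw) (by simpa using hvx)

/-- The apex joins the part of size two, so the cone over `K₂,₃` contains `K₃,₃`. -/
theorem IsOuterplanar.not_hasK23Minor [Finite V] {G : SimpleGraph V} (hG : G.IsOuterplanar) :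
    ¬ G.HasK23Minor := by
  intro h
  obtain ⟨z, P, A, S, h1, h2, h3, h4⟩ := hG.exists_cone_drawing h
  have hpos : ∀ v : Fin 6, 3 ≤ v → v ≠ 0 := by decide
  refine PlaneTopology.not_drawing_K33 (Fin.cons z P) (coneDrawing A S) ?_ ?_
  · intro u v hu hv
    obtain ⟨j, rfl⟩ := Fin.exists_succ_eq_of_ne_zero (hpos v hv)
    induction u using Fin.cases with
    | zero => simpa [coneDrawing] using h1 j
    | succ i =>
      have := h2 i j ⟨by revert hu; revert i; decide, by revert hv; revert j; decide⟩
      simpa [coneDrawing] using this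
  · intro u v w x hu hv hw hx huw hvx
    have hne : ∀ a b : Fin 6, a < 3 → 3 ≤ b → a ≠ b := by decide
    have hux := hne u x hu hx
    have hvw := (hne w v hw hv).symm
    obtain ⟨j, rfl⟩ := Fin.exists_succ_eq_of_ne_zero (hpos v hv)
    obtain ⟨l, rfl⟩ := Fin.exists_succ_eq_of_ne_zero (hpos x hx)
    induction u using Fin.cases with
    | zero =>
      obtain ⟨k, rfl⟩ := Fin.exists_succ_eq_of_ne_zero huw.symm
      simpa [coneDrawing] using h3 j k l (by simpa using hvw) (by simpa using hvx)
    | succ i =>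
      induction w using Fin.cases with
      | zero =>
        simpa [coneDrawing] using (h3 l i j (by simpa using hux.symm) (by simpa using hvx.symm)).symm
      | succ k =>
        simpa [coneDrawing] using h4 i j k l (by simpa using huw) (by simpa using hux)
          (by simpa using hvw) (by simpa using hvx)

end SimpleGraph

/-! ### Vertices with at most two neighbors, and contraction at them -/

namespace SimpleGraph

variable {V : Type*}

/-- The first `n + 1` values of `g` form a path in `G`. -/
def IsPathSeq (G : SimpleGraph V) (n : ℕ) (g : ℕ → V) : Prop :=
  (∀ t < n, G.Adj (g t) (g (t + 1))) ∧ ∀ s ≤ n, ∀ t ≤ n, g s = g t → s = t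

theorem IsPathSeq.isConnectedSet_image {G : SimpleGraph V} {n : ℕ} {g : ℕ → V}
    (h : G.IsPathSeq n g) {a b : ℕ} (hab : a ≤ b) (hb : b ≤ n) :
    G.IsConnectedSet (g '' Set.Icc a b) := by
  induction b, hab using Nat.le_induction with
  | base => simpa using G.isConnectedSet_singleton (g a)
  | succ b hab ih =>
    have e : g '' Set.Icc a (b + 1) = g '' Set.Icc a b ∪ {g (b + 1)} := by
      rw [← Set.image_singleton, ← Set.image_union]
      congr 1
      ext t
      simp only [Set.mem_Icc, Set.mem_union, Set.mem_singleton_iff]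
      omega
    rw [e]
    exact (ih (by omega)).union (G.isConnectedSet_singleton _) ⟨b, ⟨hab, le_rfl⟩, rfl⟩ rfl
      (h.1 b (by omega))

/-- Two crossing chords of a path, one of them starting at its first vertex, and one more chord from
the first vertex give a `K₄` minor. -/
theorem IsPathSeq.hasK4Minor {G : SimpleGraph V} {n : ℕ} {g : ℕ → V} (h : G.IsPathSeq n g)
    {i j k : ℕ} (hi : 2 ≤ i) (hij : i < j) (hik : i < k) (hj : j ≤ n) (hk : k ≤ n)
    (h0i : G.Adj (g 0) (g i)) (h0j : G.Adj (g 0) (g j)) (hik' : G.Adj (g (i - 1)) (g k)) :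
    G.HasK4Minor := by
  obtain ⟨m, M, him, hmM, hM, hjm, hkm⟩ : ∃ m M, i < m ∧ m ≤ M ∧ M ≤ n ∧ (m ≤ j ∧ j ≤ M) ∧
      (m ≤ k ∧ k ≤ M) := ⟨min j k, max j k, by omega, by omega, by omega, by omega, by omega⟩
  have conn : ∀ a b, a ≤ b → b ≤ n → G.IsConnectedSet (g '' Set.Icc a b) := fun a b hab hb =>
    h.isConnectedSet_image hab hb
  have disj : ∀ a b c d, b ≤ n → d ≤ n → b < c →
      Disjoint (g '' Set.Icc a b) (g '' Set.Icc c d) := by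
    intro a b c d hb hd hbc
    rw [Set.disjoint_left]
    rintro _ ⟨s, ⟨-, hs⟩, rfl⟩ ⟨t, ⟨ht, ht'⟩, e⟩
    have := h.2 t (by omega) s (by omega) e
    omega
  have mem : ∀ a b t, a ≤ t → t ≤ b → g t ∈ g '' Set.Icc a b := fun a b t h1 h2 => ⟨t, ⟨h1, h2⟩, rfl⟩
  -- The branch sets are the path intervals `{0}`, `[1, i-1]`, `[i, m-1]` and `[m, M]`; the last one
  -- contains both `j` and `k`.
  set lo : Fin 4 → ℕ := ![0, 1, i, m] with hlo
  set hi' : Fin 4 → ℕ := ![0, i - 1, m - 1, M] with hhi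
  refine ⟨fun a => g '' Set.Icc (lo a) (hi' a), ?_, ?_, ?_⟩
  · intro a
    apply conn <;> fin_cases a <;> simp [hlo, hhi] <;> omega
  · have key : ∀ a b : Fin 4, a < b →
        Disjoint (g '' Set.Icc (lo a) (hi' a)) (g '' Set.Icc (lo b) (hi' b)) := by
      intro a b hab
      have hn : ∀ a, hi' a ≤ n := by intro a; fin_cases a <;> simp [hhi] <;> omega
      refine disj _ _ _ _ (hn a) (hn b) ?_
      fin_cases a <;> fin_cases b <;> simp [hlo, hhi] at hab ⊢ <;> omega
    intro a b hab
    rcases lt_or_gt_of_ne hab with hab | hab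
    · exact key a b hab
    · exact (key b a hab).symm
  · have h1 : ∃ a ∈ g '' Set.Icc 0 0, ∃ b ∈ g '' Set.Icc 1 (i - 1), G.Adj a b :=
      ⟨g 0, mem _ _ _ le_rfl le_rfl, g 1, mem _ _ _ le_rfl (by omega), h.1 0 (by omega)⟩
    have h2 : ∃ a ∈ g '' Set.Icc 0 0, ∃ b ∈ g '' Set.Icc i (m - 1), G.Adj a b :=
      ⟨g 0, mem _ _ _ le_rfl le_rfl, g i, mem _ _ _ le_rfl (by omega), h0i⟩
    have h3 : ∃ a ∈ g '' Set.Icc 0 0, ∃ b ∈ g '' Set.Icc m M, G.Adj a b :=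
      ⟨g 0, mem _ _ _ le_rfl le_rfl, g j, mem _ _ _ hjm.1 hjm.2, h0j⟩
    have h4 : ∃ a ∈ g '' Set.Icc 1 (i - 1), ∃ b ∈ g '' Set.Icc i (m - 1), G.Adj a b := by
      refine ⟨g (i - 1), mem _ _ _ (by omega) le_rfl, g i, mem _ _ _ le_rfl (by omega), ?_⟩
      have := h.1 (i - 1) (by omega)
      rwa [Nat.sub_add_cancel (by omega)] at this
    have h5 : ∃ a ∈ g '' Set.Icc 1 (i - 1), ∃ b ∈ g '' Set.Icc m M, G.Adj a b :=
      ⟨g (i - 1), mem _ _ _ (by omega) le_rfl, g k, mem _ _ _ hkm.1 hkm.2, hik'⟩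
    have h6 : ∃ a ∈ g '' Set.Icc i (m - 1), ∃ b ∈ g '' Set.Icc m M, G.Adj a b := by
      refine ⟨g (m - 1), mem _ _ _ (by omega) le_rfl, g m, mem _ _ _ le_rfl hmM, ?_⟩
      have := h.1 (m - 1) (by omega)
      rwa [Nat.sub_add_cancel (by omega)] at this
    intro a b hab
    fin_cases a <;> fin_cases b <;> first | exact absurd hab (by decide) | assumption

/-- A graph in which every vertex that is not isolated has three neighbors has a `K₄` minor. -/
theorem hasK4Minor_of_three_neighbors [Finite V] (G : SimpleGraph V) (hE : ∃ a b, G.Adj a b)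
    (h3 : ∀ v u, G.Adj v u → ∀ a b, ∃ z, G.Adj v z ∧ z ≠ a ∧ z ≠ b) : G.HasK4Minor := by
  classical
  have := Fintype.ofFinite V
  obtain ⟨n, hn1, ⟨g, hg⟩, hmax⟩ : ∃ n, 1 ≤ n ∧ (∃ g, G.IsPathSeq n g) ∧
      ∀ m, (∃ g, G.IsPathSeq m g) → m ≤ n := by
    have hb : ∀ m, (∃ g, G.IsPathSeq m g) → m ≤ Fintype.card V := by
      rintro m ⟨g, hg⟩
      have : (Finset.range (m + 1)).card ≤ (Finset.univ : Finset V).card :=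
        Finset.card_le_card_of_injOn g (fun _ _ => Finset.mem_univ _) (by
          intro s hs t ht e
          simp only [Finset.coe_range, Set.mem_Iio] at hs ht
          exact hg.2 s (by omega) t (by omega) e)
      simp at this
      omega
    have h1 : ∃ g, G.IsPathSeq 1 g := by
      obtain ⟨a, b, hab⟩ := hE
      refine ⟨fun t => if t = 0 then a else b, ?_, ?_⟩
      · intro t ht
        obtain rfl : t = 0 := by omega
        simpa using hab
      · intro s hs t ht e
        have := hab.ne
        interval_cases s <;> interval_cases t <;> simp_all
    refine ⟨Nat.findGreatest (fun m => ∃ g, G.IsPathSeq m g) (Fintype.card V),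
      Nat.le_findGreatest (hb 1 h1) h1,
      Nat.findGreatest_spec (P := fun m => ∃ g, G.IsPathSeq m g) (hb 1 h1) h1, fun m hm =>
      Nat.le_findGreatest (hb m hm) hm⟩
  have onPath : ∀ g, G.IsPathSeq n g → ∀ z, G.Adj (g 0) z → ∃ t, 1 ≤ t ∧ t ≤ n ∧ g t = z := by
    intro g hg z hz
    by_contra! hno
    have hno' : ∀ t ≤ n, g t ≠ z := by
      intro t ht
      rcases Nat.eq_zero_or_pos t with rfl | h
      · exact hz.ne
      · exact hno t h ht
    have := hmax (n + 1) ⟨fun t => if t = 0 then z else g (t - 1), ?_, ?_⟩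
    · omega
    · intro t ht
      rcases Nat.eq_zero_or_pos t with rfl | h
      · simpa using hz.symm
      · have := hg.1 (t - 1) (by omega)
        rw [Nat.sub_add_cancel h] at this
        simpa [h.ne'] using this
    · intro s hs t ht e
      by_cases hs0 : s = 0 <;> by_cases ht0 : t = 0
      · omega
      · simp only [hs0, ht0, if_true, if_false] at e
        exact absurd e.symm (hno' _ (by omega))
      · simp only [hs0, ht0, if_true, if_false] at e
        exact absurd e (hno' _ (by omega))
      · simp only [hs0, ht0, if_false] at e
        have := hg.2 _ (by omega) _ (by omega) e
        omega
  have chord : ∀ g, G.IsPathSeq n g → ∀ k, ∃ i, 2 ≤ i ∧ i ≤ n ∧ i ≠ k ∧ G.Adj (g 0) (g i) := by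
    intro g hg k
    obtain ⟨z, hz, hz1, hzk⟩ := h3 (g 0) (g 1) (hg.1 0 (by omega)) (g 1) (g k)
    obtain ⟨t, ht, htn, rfl⟩ := onPath g hg z hz
    refine ⟨t, ?_, htn, fun e => hzk (by rw [e]), hz⟩
    by_contra! h
    exact hz1 (by rw [show t = 1 by omega])
  -- Extremal choice: among all longest paths, take one with the shortest chord at its first vertex.
  -- By maximality every neighbor of the first vertex lies on the path.
  have hex : ∃ i, 2 ≤ i ∧ i ≤ n ∧ ∃ g, G.IsPathSeq n g ∧ G.Adj (g 0) (g i) := by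
    obtain ⟨i, h1, h2, -, h4⟩ := chord g hg 0
    exact ⟨i, h1, h2, g, hg, h4⟩
  obtain ⟨hi2, hin, f, hf, hfi⟩ := Nat.find_spec hex
  have hmin : ∀ k, 2 ≤ k → k ≤ n → (∃ g, G.IsPathSeq n g ∧ G.Adj (g 0) (g k)) → Nat.find hex ≤ k :=
    fun k h1 h2 h3 => Nat.find_min' hex ⟨h1, h2, h3⟩
  set i := Nat.find hex
  obtain ⟨j, hj2, hjn, hji, hfj⟩ := chord f hf i
  have hij : i < j := lt_of_le_of_ne (hmin j hj2 hjn ⟨f, hf, hfj⟩) hji.symm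
  -- Reversing the segment before `i` and continuing along the chord gives another longest path,
  -- which starts at `f (i - 1)`. By minimality a third neighbor of that vertex lies beyond `f i`,
  -- so its chord crosses the one from `f 0` to `f i`.
  have hr : G.IsPathSeq n (fun t => if t < i then f (i - 1 - t) else f t) := by
    constructor
    · intro t ht
      by_cases h1 : t + 1 < i
      · have := hf.1 (i - 1 - (t + 1)) (by omega)
        rw [show i - 1 - (t + 1) + 1 = i - 1 - t by omega] at this
        simpa [h1, show t < i by omega] using this.symm
      · by_cases h2 : t < i
        · obtain rfl : t = i - 1 := by omega
          simpa [h2, Nat.sub_add_cancel (show 1 ≤ i by omega)] using hfi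
        · simpa [h1, h2] using hf.1 t ht
    · intro s hs t ht e
      have e' : f (if s < i then i - 1 - s else s) = f (if t < i then i - 1 - t else t) := by
        simpa only [apply_ite f] using e
      have := hf.2 _ (by split_ifs <;> omega) _ (by split_ifs <;> omega) e'
      split_ifs at this <;> omega
  obtain ⟨z, hz, hz1, hz2⟩ := h3 (f (i - 1)) (f (i - 1 + 1)) (hf.1 _ (by omega)) (f i) (f (i - 2))
  obtain ⟨t, ht1, htn, hzt⟩ := onPath _ hr z (by simpa [show 0 < i by omega] using hz)
  by_cases hti : t < i
  · exfalso
    have ht : t ≠ 1 := by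
      rintro rfl
      apply hz2
      rw [← hzt]
      simp only [hti, if_true]
      rfl
    have := hmin t (by omega) htn ⟨_, hr, by
      rw [hzt]; simpa [show 0 < i by omega] using hz⟩
    omega
  · have hzt' : f t = z := by simpa [hti] using hzt
    have : t ≠ i := by
      rintro rfl
      exact hz1 hzt'.symm
    exact hf.hasK4Minor hi2 hij (by omega) hjn htn hfi hfj (hzt' ▸ hz)

/-- The case `u = w` covers a vertex of degree one. -/
theorem exists_at_most_two_neighbors [Finite V] {G : SimpleGraph V} (hG : ¬ G.HasK4Minor)
    (hE : ∃ a b, G.Adj a b) :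
    ∃ v u w, G.Adj v u ∧ G.Adj v w ∧ ∀ z, G.Adj v z → z = u ∨ z = w := by
  by_contra! hno
  refine hG (hasK4Minor_of_three_neighbors G hE fun v u hu a b => ?_)
  by_contra! h
  by_cases ha : G.Adj v a <;> by_cases hb : G.Adj v b
  · obtain ⟨z, hz, h1, h2⟩ := hno v a b ha hb
    exact h2 (h z hz h1)
  · obtain ⟨z, hz, h1, -⟩ := hno v a a ha ha
    exact hb (h z hz h1 ▸ hz)
  · obtain ⟨z, hz, h1, -⟩ := hno v b b hb hb
    exact h1 (h z hz fun e => ha (e ▸ hz))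
  · exact hb (h u hu (fun e => ha (e ▸ hu)) ▸ hu)

/-- The graph obtained from `G` by isolating `v` and joining `u` to `w`; if `u` and `w` are the
neighbors of `v`, this is the contraction of an edge at `v`. -/
def bypass (G : SimpleGraph V) (v u w : V) : SimpleGraph V where
  Adj p q := p ≠ v ∧ q ≠ v ∧ p ≠ q ∧ (G.Adj p q ∨ (p = u ∧ q = w) ∨ (p = w ∧ q = u))
  symm := ⟨fun p q h => ⟨h.2.1, h.1, h.2.2.1.symm, by
    rcases h.2.2.2 with h | h | h
    · exact Or.inl h.symm
    · exact Or.inr (Or.inr h.symm)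
    · exact Or.inr (Or.inl h.symm)⟩⟩
  loopless := ⟨fun _ h => h.2.2.1 rfl⟩

/-- The vertex `v` is added to the branch set of `u`, where it realizes the edge `uw`. By `hr` no
branch set is the isolated vertex `v` alone. -/
theorem HasMinor.of_bypass {ι : Type*} {r : ι → ι → Prop} {G : SimpleGraph V} {v u w : V}
    (hr : ∀ i, ∃ j, r i j ∨ r j i) (hu : G.Adj v u) (hw : G.Adj v w)
    (h : HasMinor r (G.bypass v u w)) : HasMinor r G := by
  obtain ⟨X, hX, hd, hadj⟩ := h
  have hvX : ∀ i, v ∉ X i := by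
    intro i hv
    have hsub : ∀ a ∈ X i, a = v := by
      intro a ha
      have := (hX i).2 v hv a ha
      rcases Relation.ReflTransGen.cases_head this with h | ⟨c, hc, -⟩
      · exact h.symm
      · exact absurd rfl hc.1.1
    obtain ⟨j, hj | hj⟩ := hr i
    · obtain ⟨a, ha, b, -, hab⟩ := hadj i j hj
      exact hab.1 (hsub a ha)
    · obtain ⟨a, -, b, hb, hab⟩ := hadj j i hj
      exact hab.2.1 (hsub b hb)
  set Y : ι → Set V := fun i => X i ∪ {p | p = v ∧ u ∈ X i} with hY
  have hXY : ∀ i, X i ⊆ Y i := fun i => Set.subset_union_left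
  have hvY : ∀ i, u ∈ X i → v ∈ Y i := fun i h => Or.inr ⟨rfl, h⟩
  refine ⟨Y, ?_, ?_, ?_⟩
  · intro i
    have step : ∀ p ∈ X i, ∀ q, (G.bypass v u w).Adj p q ∧ q ∈ X i →
        Relation.ReflTransGen (fun p q => G.Adj p q ∧ q ∈ Y i) p q := by
      rintro p hp q ⟨hpq, hq⟩
      rcases hpq.2.2.2 with h | ⟨rfl, rfl⟩ | ⟨rfl, rfl⟩
      · exact .single ⟨h, hXY i hq⟩
      · exact (Relation.ReflTransGen.single ⟨hu.symm, hvY i hp⟩).tail ⟨hw, hXY i hq⟩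
      · exact (Relation.ReflTransGen.single ⟨hw.symm, hvY i hq⟩).tail ⟨hu, hXY i hq⟩
    have conn : ∀ a ∈ X i, ∀ b ∈ X i,
        Relation.ReflTransGen (fun p q => G.Adj p q ∧ q ∈ Y i) a b := by
      intro a ha b hb
      have := (hX i).2 a ha b hb
      clear hb
      have h2 : b ∈ X i ∧ Relation.ReflTransGen (fun p q => G.Adj p q ∧ q ∈ Y i) a b := by
        induction this with
        | refl => exact ⟨ha, .refl⟩
        | tail _ h ih => exact ⟨h.2, ih.2.trans (step _ ih.1 _ h)⟩
      exact h2.2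
    refine ⟨(hX i).1.mono (hXY i), ?_⟩
    rintro a (ha | ⟨rfl, ha⟩) b (hb | ⟨rfl, hb⟩)
    · exact conn a ha b hb
    · exact (conn a ha u hb).tail ⟨hu.symm, hvY i hb⟩
    · exact .head ⟨hu, hXY i ha⟩ (conn u ha b hb)
    · exact .refl
  · intro i j hij
    have := Set.disjoint_left.1 (hd i j hij)
    rw [Set.disjoint_left]
    rintro a (ha | ⟨hav, ha⟩) (hb | ⟨hbv, hb⟩)
    · exact this ha hb
    · exact hvX i (hbv ▸ ha)
    · exact hvX j (hav ▸ hb)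
    · exact this ha hb
  · intro i j hij
    obtain ⟨a, ha, b, hb, hab⟩ := hadj i j hij
    rcases hab.2.2.2 with h | ⟨rfl, rfl⟩ | ⟨rfl, rfl⟩
    · exact ⟨a, hXY i ha, b, hXY j hb, h⟩
    · exact ⟨v, hvY i ha, b, hXY j hb, hw⟩
    · exact ⟨a, hXY i ha, v, hvY j hb, hw.symm⟩

end SimpleGraph

/-! ### Noncrossing placement on a line -/

namespace SimpleGraph

variable {V : Type*}

/-- The positions `f` of the vertices on a line are such that no two edges, drawn as half circles
above the line, cross. -/
structure IsNoncrossing (G : SimpleGraph V) (f : V → ℤ) : Prop where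
  injective : Function.Injective f
  not_crossing : ∀ a b c d, G.Adj a b → G.Adj c d → f a < f c → f c < f b → f b < f d → False

/-- Crossing depends only on the cyclic order. This lets the outer side of an edge be treated as its
inner side. -/
theorem IsNoncrossing.rotate {G : SimpleGraph V} {f : V → ℤ} (h : G.IsNoncrossing f) {M : ℤ}
    (hM : ∀ x y, f x < f y + M) (m : ℤ) :
    G.IsNoncrossing (fun x => if f x < m then f x + M else f x) := by
  constructor
  · intro x y hxy
    have h1 := hM x y
    have h2 := hM y x
    apply h.injective
    dsimp only at hxy
    split_ifs at hxy <;> omega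
  · intro a b c d hab hcd h1 h2 h3
    have := hM c a
    have := hM b c
    have := hM d b
    by_cases ha : f a < m
    · have hc : f c < m := by split_ifs at h1 <;> omega
      have hb : f b < m := by split_ifs at h2 <;> omega
      have hd : f d < m := by split_ifs at h3 <;> omega
      simp only [ha, hb, hc, hd, if_true] at h1 h2 h3
      exact h.not_crossing a b c d hab hcd (by omega) (by omega) (by omega)
    by_cases hc : f c < m
    · have hb : f b < m := by split_ifs at h2 <;> omega
      have hd : f d < m := by split_ifs at h3 <;> omega
      simp only [ha, hb, hc, hd, if_true, if_false] at h1 h2 h3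
      exact h.not_crossing c d b a hcd hab.symm (by omega) (by omega) (by omega)
    by_cases hb : f b < m
    · have hd : f d < m := by split_ifs at h3 <;> omega
      simp only [ha, hb, hc, hd, if_true, if_false] at h1 h2 h3
      exact h.not_crossing b a d c hab.symm hcd.symm (by omega) (by omega) (by omega)
    by_cases hd : f d < m
    · simp only [ha, hb, hc, hd, if_true, if_false] at h1 h2 h3
      exact h.not_crossing d c a b hcd.symm hab (by omega) (by omega) (by omega)
    simp only [ha, hb, hc, hd, if_false] at h1 h2 h3
    exact h.not_crossing a b c d hab hcd (by omega) (by omega) (by omega)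

open Classical in
/-- Move the vertex `v` to the place directly after `t`. -/
noncomputable def moveTo (f : V → ℤ) (v : V) (t : ℤ) : V → ℤ :=
  fun x => if x = v then 2 * t + 1 else 2 * f x

theorem moveTo_injective {f : V → ℤ} (hf : Function.Injective f) (v : V) (t : ℤ) :
    Function.Injective (moveTo f v t) := by
  intro x y hxy
  simp only [moveTo] at hxy
  split_ifs at hxy with h1 h2 h2
  · rw [h1, h2]
  · omega
  · omega
  · exact hf (by omega)

/-- A vertex with at most two neighbors can be inserted below an edge between these neighbors, if
there is room for it. -/
theorem IsNoncrossing.insert_two {G H : SimpleGraph V} {f : V → ℤ} (hf : H.IsNoncrossing f)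
    {v u w : V} (hv : ∀ z, G.Adj v z → z = u ∨ z = w)
    (hGH : ∀ p q, p ≠ v → q ≠ v → G.Adj p q → H.Adj p q) (huw : H.Adj u w) (huv : u ≠ v)
    (hwv : w ≠ v) {t : ℤ} (hut : f u ≤ t) (htw : t < f w)
    (hgap : ∀ a b, H.Adj a b → f u ≤ f a → f a ≤ t → t < f b → f b ≤ f w → a = u ∧ b = w) :
    G.IsNoncrossing (moveTo f v t) := by
  refine ⟨moveTo_injective hf.injective v t, ?_⟩
  intro a b c d hab hcd h1 h2 h3
  simp only [moveTo] at h1 h2 h3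
  by_cases ha : a = v
  · subst ha
    have hb := hab.ne'
    have hc : c ≠ a := by rintro rfl; simp at h1
    have hd : d ≠ a := by rintro rfl; simp only [if_true, hb, hc, if_false] at h1 h2 h3; omega
    simp only [if_true, hb, hc, hd, if_false] at h1 h2 h3
    rcases hv b hab with rfl | rfl
    · omega
    · exact hf.not_crossing u b c d huw (hGH c d hc hd hcd) (by omega) (by omega) (by omega)
  by_cases hb : b = v
  · subst hb
    have hc : c ≠ b := by rintro rfl; simp at h2
    have hd : d ≠ b := by rintro rfl; simp at h3
    simp only [if_true, ha, hc, hd, if_false] at h1 h2 h3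
    rcases hv a hab.symm with rfl | rfl
    · by_cases hdw : f d ≤ f w
      · have := hgap c d (hGH c d hc hd hcd) (by omega) (by omega) (by omega) hdw
        rw [this.1] at h1
        omega
      · exact hf.not_crossing a w c d huw (hGH c d hc hd hcd) (by omega) (by omega) (by omega)
    · omega
  by_cases hc : c = v
  · subst hc
    have hd := hcd.ne'
    simp only [if_true, ha, hb, hd, if_false] at h1 h2 h3
    rcases hv d hcd with rfl | rfl
    · omega
    · by_cases hau : f u ≤ f a
      · have := hgap a b (hGH a b ha hb hab) (by omega) (by omega) (by omega) (by omega)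
        rw [this.2] at h3
        omega
      · exact hf.not_crossing a b u d (hGH a b ha hb hab) huw (by omega) (by omega) (by omega)
  by_cases hd : d = v
  · subst hd
    simp only [if_true, ha, hb, hc, if_false] at h1 h2 h3
    rcases hv c hcd.symm with rfl | rfl
    · exact hf.not_crossing a b c w (hGH a b ha hb hab) huw (by omega) (by omega) (by omega)
    · omega
  simp only [ha, hb, hc, hd, if_false] at h1 h2 h3
  exact hf.not_crossing a b c d (hGH a b ha hb hab) (hGH c d hc hd hcd) (by omega) (by omega)
    (by omega)

theorem IsNoncrossing.insert_one {G H : SimpleGraph V} {f : V → ℤ} (hf : H.IsNoncrossing f)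
    {v u : V} (hv : ∀ z, G.Adj v z → z = u)
    (hGH : ∀ p q, p ≠ v → q ≠ v → G.Adj p q → H.Adj p q) (huv : u ≠ v) :
    G.IsNoncrossing (moveTo f v (f u)) := by
  refine ⟨moveTo_injective hf.injective v _, ?_⟩
  intro a b c d hab hcd h1 h2 h3
  simp only [moveTo] at h1 h2 h3
  by_cases ha : a = v
  · subst ha
    obtain rfl := hv b hab
    simp only [huv, if_true, if_false] at h1 h2
    split_ifs at h1 h2 <;> omega
  by_cases hb : b = v
  · subst hb
    obtain rfl := hv a hab.symm
    simp only [huv, if_true, if_false] at h1 h2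
    split_ifs at h1 h2 <;> omega
  by_cases hc : c = v
  · subst hc
    obtain rfl := hv d hcd
    simp only [huv, if_true, if_false] at h2 h3
    split_ifs at h2 h3
    omega
  by_cases hd : d = v
  · subst hd
    obtain rfl := hv c hcd.symm
    simp only [huv, if_true, if_false] at h2 h3
    split_ifs at h2 h3
    omega
  simp only [ha, hb, hc, hd, if_false] at h1 h2 h3
  exact hf.not_crossing a b c d (hGH a b ha hb hab) (hGH c d hc hd hcd) (by omega) (by omega)
    (by omega)

theorem isConnectedSet_reachable (G : SimpleGraph V) (I : Set V) (c : V) :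
    G.IsConnectedSet {x | Relation.ReflTransGen (fun p q => G.Adj p q ∧ q ∈ I) c x} := by
  set P := {x | Relation.ReflTransGen (fun p q => G.Adj p q ∧ q ∈ I) c x} with hP
  have key : ∀ x ∈ P, Relation.ReflTransGen (fun p q => G.Adj p q ∧ q ∈ P) c x ∧
      Relation.ReflTransGen (fun p q => G.Adj p q ∧ q ∈ P) x c := by
    intro x hx
    induction hx with
    | refl => exact ⟨.refl, .refl⟩
    | tail h1 h2 ih => exact ⟨ih.1.tail ⟨h2.1, h1.tail h2⟩, .head ⟨h2.1.symm, h1⟩ ih.2⟩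
  exact ⟨⟨c, .refl⟩, fun a ha b hb => (key a ha).2.trans (key b hb).1⟩

/-- If there is no room below the edge `uw`, then `u` and `w` are connected below this edge. -/
theorem IsNoncrossing.exists_connection [Finite V] {H : SimpleGraph V} {f : V → ℤ}
    (hf : H.IsNoncrossing f) {u w : V} (huw : f u < f w)
    (hgap : ∀ t, f u ≤ t → t < f w → ∃ a b, H.Adj a b ∧ f u ≤ f a ∧ f a ≤ t ∧ t < f b ∧
      f b ≤ f w ∧ ¬ (a = u ∧ b = w)) :
    ∃ P : Set V, H.IsConnectedSet P ∧ (∀ x ∈ P, f u < f x ∧ f x < f w ∧ ∃ y, H.Adj y x) ∧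
      (∃ p ∈ P, H.Adj u p) ∧ ∃ q ∈ P, H.Adj w q := by
  set I : Set V := {x | f u < f x ∧ f x < f w} with hI
  set R : Set V := {x | Relation.ReflTransGen (fun p q => H.Adj p q ∧ q ∈ I) u x} with hR
  obtain ⟨t, htR, hmax⟩ := Set.exists_max_image R f (Set.toFinite R) ⟨u, .refl⟩
  have hRI : ∀ x ∈ R, f u ≤ f x ∧ f x < f w := by
    intro x hx
    rcases Relation.ReflTransGen.cases_tail hx with rfl | ⟨y, -, hy⟩
    · exact ⟨le_rfl, huw⟩
    · exact ⟨hy.2.1.le, hy.2.2⟩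
  obtain ⟨a, b, hab, h1, h2, h3, h4, h5⟩ := hgap (f t) (hRI t htR).1 (hRI t htR).2
  -- Otherwise a path in `R` from `u` to its last vertex `t` would have to step over `a` and land
  -- below `ab`, crossing this edge.
  have haR : a ∈ R := by
    by_contra ha
    have hua : f u < f a := lt_of_le_of_ne h1 fun e => ha (hf.injective e ▸ .refl)
    have : ∀ x ∈ R, f x < f a := by
      intro x hx
      induction hx with
      | refl => exact hua
      | @tail p q hp hq ih =>
        have hqR : q ∈ R := Relation.ReflTransGen.tail hp hq
        by_contra hqa
        have hne : f q ≠ f a := fun e => ha (hf.injective e ▸ hqR)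
        exact hf.not_crossing p q a b hq.1 hab ih (by omega) (by have := hmax q hqR; omega)
    have := this t htR
    omega
  have hbw : b = w := by
    by_contra hb
    have hlt : f b < f w := lt_of_le_of_ne h4 fun e => hb (hf.injective e)
    have : b ∈ R := Relation.ReflTransGen.tail haR ⟨hab, by omega, hlt⟩
    have := hmax b this
    omega
  subst hbw
  rcases Relation.ReflTransGen.cases_head haR with rfl | ⟨c, hc, hca⟩
  · exact absurd ⟨rfl, rfl⟩ h5
  · refine ⟨_, H.isConnectedSet_reachable I c, ?_, ⟨c, .refl, hc.1⟩, a, hca, hab.symm⟩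
    intro x hx
    rcases Relation.ReflTransGen.cases_tail hx with rfl | ⟨y, -, hy⟩
    · exact ⟨hc.2.1, hc.2.2, u, hc.1⟩
    · exact ⟨hy.2.1, hy.2.2, y, hy.1⟩

/-- The parts are `{u}, {w}` and `P, Q, {v}`: three disjoint connections between `u` and `w`. -/
theorem hasK23Minor_of_connections {G : SimpleGraph V} {v u w : V} {P Q : Set V} (hu : G.Adj v u)
    (hw : G.Adj v w) (huw : u ≠ w) (hP : (G.bypass v u w).IsConnectedSet P)
    (hQ : (G.bypass v u w).IsConnectedSet Q) (hPQ : Disjoint P Q) (huP : u ∉ P) (hwP : w ∉ P)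
    (huQ : u ∉ Q) (hwQ : w ∉ Q) (hvP : v ∉ P) (hvQ : v ∉ Q)
    (h1 : ∃ p ∈ P, (G.bypass v u w).Adj u p) (h2 : ∃ p ∈ P, (G.bypass v u w).Adj w p)
    (h3 : ∃ p ∈ Q, (G.bypass v u w).Adj u p) (h4 : ∃ p ∈ Q, (G.bypass v u w).Adj w p) :
    G.HasK23Minor := by
  have adj : ∀ p q, q ≠ u → q ≠ w → (G.bypass v u w).Adj p q → G.Adj p q := by
    intro p q hqu hqw h
    rcases h.2.2.2 with h | h | h
    · exact h
    · exact absurd h.2 hqw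
    · exact absurd h.2 hqu
  have conn : ∀ X : Set V, u ∉ X → w ∉ X → (G.bypass v u w).IsConnectedSet X →
      G.IsConnectedSet X := by
    intro X huX hwX hX
    refine ⟨hX.1, fun a ha b hb => Relation.ReflTransGen.mono ?_ _ _ (hX.2 a ha b hb)⟩
    intro p q h
    exact ⟨adj p q (fun e => huX (e ▸ h.2)) (fun e => hwX (e ▸ h.2)) h.1, h.2⟩
  have nbr : ∀ X : Set V, u ∉ X → w ∉ X → ∀ z, (∃ p ∈ X, (G.bypass v u w).Adj z p) →
      ∃ a ∈ ({z} : Set V), ∃ b ∈ X, G.Adj a b := by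
    rintro X huX hwX z ⟨p, hp, h⟩
    exact ⟨z, rfl, p, hp, adj z p (fun e => huX (e ▸ hp)) (fun e => hwX (e ▸ hp)) h⟩
  refine ⟨![{u}, {w}, P, Q, {v}], ?_, ?_, ?_⟩
  · intro i
    fin_cases i
    · exact G.isConnectedSet_singleton u
    · exact G.isConnectedSet_singleton w
    · exact conn P huP hwP hP
    · exact conn Q huQ hwQ hQ
    · exact G.isConnectedSet_singleton v
  · have key : ∀ i j : Fin 5, i < j → Disjoint ((![{u}, {w}, P, Q, {v}] : Fin 5 → Set V) i)
        ((![{u}, {w}, P, Q, {v}] : Fin 5 → Set V) j) := by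
      intro i j hij
      have := hu.ne'
      have := hw.ne'
      fin_cases i <;> fin_cases j <;> first | exact absurd hij (by decide) | simp_all
    intro i j hij
    rcases lt_or_gt_of_ne hij with h | h
    · exact key i j h
    · exact (key j i h).symm
  · have e : ∀ z, G.Adj v z → ∃ a ∈ ({z} : Set V), ∃ b ∈ ({v} : Set V), G.Adj a b :=
      fun z hz => ⟨z, rfl, v, rfl, hz.symm⟩
    have := nbr P huP hwP u h1
    have := nbr P huP hwP w h2
    have := nbr Q huQ hwQ u h3
    have := nbr Q huQ hwQ w h4
    have := e u hu
    have := e w hw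
    intro i j hij
    fin_cases i <;> fin_cases j <;> first | exact absurd hij (by decide) | assumption

/-- A finite graph without `K₄` minor and `K₂,₃` minor has a drawing with the vertices on a line and
the edges as half circles above the line in which no edges cross. -/
theorem exists_isNoncrossing [Finite V] (G : SimpleGraph V) (h4 : ¬ G.HasK4Minor)
    (h23 : ¬ G.HasK23Minor) : ∃ f : V → ℤ, G.IsNoncrossing f := by
  induction hn : {x | ∃ y, G.Adj x y}.ncard using Nat.strong_induction_on generalizing G with
  | _ n ih =>
    by_cases hE : ∃ a b, G.Adj a b
    swap
    · have := Fintype.ofFinite V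
      refine ⟨fun x => ((Fintype.equivFin V x : ℕ) : ℤ), ?_, fun a b _ _ h => absurd ⟨a, b, h⟩ hE⟩
      intro x y h
      simpa [Fin.val_inj] using h
    obtain ⟨v, u, w, hu, hw, hv⟩ := exists_at_most_two_neighbors h4 hE
    obtain ⟨f, hf⟩ := ih _ (by
        rw [← hn]
        refine Set.ncard_lt_ncard ?_ (Set.toFinite _)
        refine (Set.ssubset_iff_of_subset ?_).2 ⟨v, ⟨u, hu⟩, fun ⟨y, hy⟩ => hy.1 rfl⟩
        rintro x ⟨y, -, -, -, h | ⟨rfl, -⟩ | ⟨rfl, -⟩⟩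
        · exact ⟨y, h⟩
        · exact ⟨v, hu.symm⟩
        · exact ⟨v, hw.symm⟩) (G.bypass v u w)
      (fun h => h4 (h.of_bypass (by decide) hu hw)) (fun h => h23 (h.of_bypass (by decide) hu hw))
      rfl
    have hGH : ∀ p q, p ≠ v → q ≠ v → G.Adj p q → (G.bypass v u w).Adj p q :=
      fun p q hp hq h => ⟨hp, hq, h.ne, Or.inl h⟩
    by_cases huw : u = w
    · subst huw
      exact ⟨_, hf.insert_one (fun z hz => (hv z hz).elim id id) hGH hu.ne'⟩
    have hH : (G.bypass v u w).Adj u w := ⟨hu.ne', hw.ne', huw, Or.inr (Or.inl ⟨rfl, rfl⟩)⟩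
    clear hn ih
    wlog hlt : f u < f w generalizing u w
    · have hb : G.bypass v u w = G.bypass v w u := by
        ext p q
        simp only [bypass]
        tauto
      exact this w u hw hu (fun z hz => (hv z hz).symm) (hb ▸ hf) (hb ▸ hGH) (Ne.symm huw)
        (hb ▸ hH.symm) (lt_of_le_of_ne (not_lt.1 hlt) fun e => huw (hf.injective e).symm)
    by_cases hgap : ∃ t, f u ≤ t ∧ t < f w ∧ ∀ a b, (G.bypass v u w).Adj a b → f u ≤ f a →
        f a ≤ t → t < f b → f b ≤ f w → a = u ∧ b = w
    · obtain ⟨t, h1, h2, h3⟩ := hgap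
      exact ⟨_, hf.insert_two hv hGH hH hu.ne' hw.ne' h1 h2 h3⟩
    push Not at hgap
    obtain ⟨P, hP, hPI, hPu, hPw⟩ := hf.exists_connection hlt (fun t h1 h2 => by
      obtain ⟨a, b, h⟩ := hgap t h1 h2
      exact ⟨a, b, by tauto⟩)
    obtain ⟨M, hM⟩ : ∃ M : ℤ, ∀ x y, f x < f y + M := by
      obtain ⟨B, hB⟩ := (Set.finite_range fun p : V × V => f p.1 - f p.2).bddAbove
      refine ⟨B + 1, fun x y => ?_⟩
      have := hB ⟨(x, y), rfl⟩
      dsimp only at this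
      omega
    -- The rotation puts `w` first, so the vertices outside the interval from `u` to `w` now lie
    -- below the edge `wu`.
    have hf' := hf.rotate hM (f w)
    set f' : V → ℤ := fun x => if f x < f w then f x + M else f x with hdef
    have hfu : f' u = f u + M := by simp [hdef, hlt]
    have hfw : f' w = f w := by simp [hdef]
    have hlt' : f' w < f' u := by rw [hfu, hfw]; exact hM w u
    by_cases hgap' : ∃ t, f' w ≤ t ∧ t < f' u ∧ ∀ a b, (G.bypass v u w).Adj a b → f' w ≤ f' a →
        f' a ≤ t → t < f' b → f' b ≤ f' u → a = w ∧ b = u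
    · obtain ⟨t, h1, h2, h3⟩ := hgap'
      exact ⟨_, hf'.insert_two (fun z hz => (hv z hz).symm) hGH hH.symm hw.ne' hu.ne' h1 h2 h3⟩
    push Not at hgap'
    obtain ⟨Q, hQ, hQI, hQw, hQu⟩ := hf'.exists_connection hlt' (fun t h1 h2 => by
      obtain ⟨a, b, h⟩ := hgap' t h1 h2
      exact ⟨a, b, by tauto⟩)
    refine absurd (hasK23Minor_of_connections hu hw huw hP hQ ?_ ?_ ?_ ?_ ?_ ?_ ?_ hPu hPw hQu hQw)
      h23
    · rw [Set.disjoint_left]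
      intro x hx hx'
      have h1 := hPI x hx
      have h2 := hQI x hx'
      have : f' x = f x + M := by simp [hdef, h1.2.1]
      omega
    · exact fun h => lt_irrefl _ (hPI u h).1
    · exact fun h => lt_irrefl _ (hPI w h).2.1
    · exact fun h => lt_irrefl _ (hQI u h).2.1
    · exact fun h => lt_irrefl _ (hQI w h).1
    · intro h
      obtain ⟨y, hy⟩ := (hPI v h).2.2
      exact hy.2.1 rfl
    · intro h
      obtain ⟨y, hy⟩ := (hQI v h).2.2
      exact hy.2.1 rfl

theorem IsOuterplanar.exists_isNoncrossing [Finite V] {G : SimpleGraph V} (hG : G.IsOuterplanar) :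
    ∃ f : V → ℤ, G.IsNoncrossing f :=
  G.exists_isNoncrossing hG.not_hasK4Minor hG.not_hasK23Minor

end SimpleGraph

/-! ### Critical graphs: edge types and square degree bounds -/

namespace SimpleGraph

variable {V : Type*} [LinearOrder V]

/-- A graph with linearly ordered vertices and noncrossing edges, with degrees at most `k`, in which
every vertex with at most two neighbors has more than `k` neighbors in the square. -/
structure IsCritical [Fintype V] (G : SimpleGraph V) [DecidableRel G.Adj] [DecidableRel G.square.Adj]
    (k : ℕ) : Prop where
  not_crossing : ∀ a b c d, G.Adj a b → G.Adj c d → a < c → c < b → b < d → False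
  six_le : 6 ≤ k
  degree_le : ∀ v, G.degree v ≤ k
  seven_le_or : 7 ≤ k ∨ ∀ v, G.degree v < k
  lt_degree_square : ∀ v u w, G.Adj v u → G.Adj v w → (∀ z, G.Adj v z → z = u ∨ z = w) →
    k < G.square.degree v

/-- The only edge between `a` and `b` is the edge `ab`. -/
def IsEmptyEdge (G : SimpleGraph V) (a b : V) : Prop :=
  G.Adj a b ∧ a < b ∧ ∀ u v, G.Adj u v → a ≤ u → u < v → v ≤ b → u = a ∧ v = b

/-- The only edges between `a` and `b` are those of the triangle `apb`. -/
def IsEar (G : SimpleGraph V) (a p b : V) : Prop :=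
  G.Adj a b ∧ G.IsEmptyEdge a p ∧ G.IsEmptyEdge p b ∧
    ∀ u v, G.Adj u v → a ≤ u → u < v → v ≤ b → (u = a ∧ v = b) ∨ v ≤ p ∨ p ≤ u

section

variable [Fintype V] (G : SimpleGraph V) [DecidableRel G.Adj]

/-- The number of neighbors of `a` in the interval from `a` to `b`. -/
def leftCount (a b : V) : ℕ := ((G.neighborFinset a).filter fun z => a < z ∧ z ≤ b).card

/-- The number of neighbors of `b` in the interval from `a` to `b`. -/
def rightCount (a b : V) : ℕ := ((G.neighborFinset b).filter fun z => a ≤ z ∧ z < b).card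

/-- Both ends of the edge `ab` have large degree, but few neighbors between `a` and `b`. -/
def IsHeavy (k : ℕ) (a b : V) : Prop :=
  G.leftCount a b ≤ 3 ∧ G.rightCount a b ≤ 3 ∧
    ((k ≤ G.degree a ∧ k ≤ G.degree b) ∨
      (k ≤ G.degree a ∧ k ≤ G.degree b + 1 ∧ G.rightCount a b ≤ 2) ∨
      (k ≤ G.degree b ∧ k ≤ G.degree a + 1 ∧ G.leftCount a b ≤ 2))

end

variable {G : SimpleGraph V}

namespace IsEmptyEdge

variable {a b z : V}

theorem left (h : G.IsEmptyEdge a b) (hz : G.Adj a z) (h1 : a < z) (h2 : z ≤ b) : z = b :=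
  (h.2.2 a z hz le_rfl h1 h2).2

theorem right (h : G.IsEmptyEdge a b) (hz : G.Adj b z) (h1 : a ≤ z) (h2 : z < b) : z = a :=
  (h.2.2 z b hz.symm h1 h2 le_rfl).1

theorem leftCount_le [Fintype V] [DecidableRel G.Adj] (h : G.IsEmptyEdge a b) : G.leftCount a b ≤ 1 := by
  refine (Finset.card_le_card (t := {b}) fun z hz => ?_).trans (by simp)
  simp only [Finset.mem_filter, mem_neighborFinset] at hz
  simp [h.left hz.1 hz.2.1 hz.2.2]

theorem rightCount_le [Fintype V] [DecidableRel G.Adj] (h : G.IsEmptyEdge a b) : G.rightCount a b ≤ 1 := by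
  refine (Finset.card_le_card (t := {a}) fun z hz => ?_).trans (by simp)
  simp only [Finset.mem_filter, mem_neighborFinset] at hz
  simp [h.right hz.1 hz.2.1 hz.2.2]

end IsEmptyEdge

namespace IsEar

variable {a p b z : V}

theorem lt_left (h : G.IsEar a p b) : a < p := h.2.1.2.1

theorem lt_right (h : G.IsEar a p b) : p < b := h.2.2.1.2.1

theorem adj_left (h : G.IsEar a p b) : G.Adj a p := h.2.1.1

theorem adj_right (h : G.IsEar a p b) : G.Adj p b := h.2.2.1.1

theorem left (h : G.IsEar a p b) (hz : G.Adj a z) (h1 : a < z) (h2 : z ≤ b) :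
    z = p ∨ z = b := by
  rcases h.2.2.2 a z hz le_rfl h1 h2 with h3 | h3 | h3
  · exact Or.inr h3.2
  · exact Or.inl (h.2.1.left hz h1 h3)
  · exact absurd h.lt_left (not_lt.2 h3)

theorem right (h : G.IsEar a p b) (hz : G.Adj b z) (h1 : a ≤ z) (h2 : z < b) :
    z = a ∨ z = p := by
  rcases h.2.2.2 z b hz.symm h1 h2 le_rfl with h3 | h3 | h3
  · exact Or.inl h3.1
  · exact absurd h.lt_right (not_lt.2 h3)
  · exact Or.inr (h.2.2.1.right hz h3 h2)

theorem mid (h : G.IsEar a p b)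
    (hc : ∀ a b c d, G.Adj a b → G.Adj c d → a < c → c < b → b < d → False) (hz : G.Adj p z) :
    z = a ∨ z = b := by
  rcases lt_trichotomy z p with hzp | rfl | hzp
  · refine Or.inl (h.2.1.right hz ?_ hzp)
    by_contra! hza
    exact hc z p a b hz.symm h.1 hza h.lt_left h.lt_right
  · exact absurd hz (G.loopless.irrefl _)
  · refine Or.inr (h.2.2.1.left hz hzp ?_)
    by_contra! hza
    exact hc a b p z h.1 hz h.lt_left h.lt_right hza

theorem leftCount_le [Fintype V] [DecidableRel G.Adj] (h : G.IsEar a p b) : G.leftCount a b ≤ 2 := by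
  refine (Finset.card_le_card (t := {p, b}) fun z hz => ?_).trans Finset.card_le_two
  simp only [Finset.mem_filter, mem_neighborFinset] at hz
  simpa using h.left hz.1 hz.2.1 hz.2.2

theorem rightCount_le [Fintype V] [DecidableRel G.Adj] (h : G.IsEar a p b) : G.rightCount a b ≤ 2 := by
  refine (Finset.card_le_card (t := {a, p}) fun z hz => ?_).trans Finset.card_le_two
  simp only [Finset.mem_filter, mem_neighborFinset] at hz
  simpa using h.right hz.1 hz.2.1 hz.2.2

end IsEar

variable [Fintype V] [DecidableRel G.Adj]

namespace IsCritical

/-- The possible configurations at an edge `ab` of a critical graph. -/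
def Config (G : SimpleGraph V) [DecidableRel G.Adj] (k : ℕ) (a b : V) : Prop :=
  G.IsEmptyEdge a b ∨ (∃ p, G.IsEar a p b) ∨ G.IsHeavy k a b

theorem Config.leftCount_le {k : ℕ} {a b : V} (h : Config G k a b) : G.leftCount a b ≤ 3 := by
  rcases h with h | ⟨p, h⟩ | h
  · exact h.leftCount_le.trans (by omega)
  · exact h.leftCount_le.trans (by omega)
  · exact h.1

theorem Config.rightCount_le {k : ℕ} {a b : V} (h : Config G k a b) : G.rightCount a b ≤ 3 := by
  rcases h with h | ⟨p, h⟩ | h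
  · exact h.rightCount_le.trans (by omega)
  · exact h.rightCount_le.trans (by omega)
  · exact h.2.1

theorem degree_eq {a b c : V} (h1 : ∀ z, G.Adj b z → z < b → a ≤ z)
    (h2 : ∀ z, G.Adj b z → z ≤ c) : G.degree b = G.rightCount a b + G.leftCount b c := by
  rw [rightCount, leftCount, ← Finset.card_union_of_disjoint, ← card_neighborFinset_eq_degree]
  · congr 1
    ext z
    simp only [mem_neighborFinset, Finset.mem_union, Finset.mem_filter]
    constructor
    · intro h
      rcases lt_or_gt_of_ne h.ne with h' | h'
      · exact Or.inr ⟨h, h', h2 z h⟩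
      · exact Or.inl ⟨h, h1 z h h', h'⟩
    · rintro (h | h) <;> exact h.1
  · rw [Finset.disjoint_left]
    intro z hz hz'
    simp only [Finset.mem_filter] at hz hz'
    exact lt_asymm hz.2.2 hz'.2.1

end IsCritical

variable [DecidableRel G.square.Adj]

/-- The set `T` collects the vertices near `v` that are not neighbors of `c`. In a critical graph
this becomes the lower bound `k + 2 - T.card` for the degree of `c`. -/
theorem degree_square_add_one_le {v u w c : V} (hN : ∀ z, G.Adj v z → z = u ∨ z = w)
    (T : Finset V) (hc : G.Adj c v)
    (h : ∀ x, x ≠ v → (x = u ∨ x = w ∨ G.Adj u x ∨ G.Adj w x) → x ∈ T ∨ G.Adj c x) :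
    G.square.degree v + 1 ≤ T.card + G.degree c := by
  have h1 : G.square.neighborFinset v ⊆ T ∪ (G.neighborFinset c).erase v := by
    intro x hx
    rw [mem_neighborFinset] at hx
    obtain ⟨hxv, hx⟩ := hx
    have : x = u ∨ x = w ∨ G.Adj u x ∨ G.Adj w x := by
      rcases hx with hx | ⟨z, hz, hxz⟩
      · rcases hN x hx with h | h <;> simp [h]
      · rcases hN z hz with rfl | rfl <;> simp [hxz.symm]
    rcases h x hxv.symm this with h | h
    · exact Finset.mem_union_left _ h
    · exact Finset.mem_union_right _ (Finset.mem_erase.2 ⟨hxv.symm, by simpa using h⟩)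
  have h2 := (Finset.card_le_card h1).trans (Finset.card_union_le _ _)
  have h3 := Finset.card_erase_add_one ((G.mem_neighborFinset c v).2 hc)
  simp only [card_neighborFinset_eq_degree] at h2 h3
  omega

/-- As `u` and `w` are adjacent, the neighborhoods of `u` and `w` without `v` already contain both
of them. -/
theorem degree_square_add_two_le {v u w : V} (hu : G.Adj v u) (hw : G.Adj v w)
    (hN : ∀ z, G.Adj v z → z = u ∨ z = w) (huw : G.Adj u w) :
    G.square.degree v + 2 ≤ G.degree u + G.degree w := by
  have h1 := degree_square_add_one_le hN ((G.neighborFinset w).erase v) hu.symm (by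
    rintro x hxv (rfl | rfl | h | h)
    · left; simp [hxv, huw.symm]
    · right; exact huw
    · right; exact h
    · left; simp [hxv, h])
  have h3 := Finset.card_erase_add_one ((G.mem_neighborFinset w v).2 hw.symm)
  simp only [card_neighborFinset_eq_degree] at h3
  omega

theorem degree_square_le {v u w : V} (hu : G.Adj v u) (hw : G.Adj v w)
    (hN : ∀ z, G.Adj v z → z = u ∨ z = w) :
    G.square.degree v ≤ G.degree u + G.degree w := by
  have h1 := degree_square_add_one_le hN ({u, w} ∪ (G.neighborFinset w).erase v) hu.symm (by
    rintro x hxv (rfl | rfl | h | h)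
    · left; simp
    · left; simp
    · right; exact h
    · left; simp [hxv, h])
  have h2 := Finset.card_union_le {u, w} ((G.neighborFinset w).erase v)
  have h3 := Finset.card_erase_add_one ((G.mem_neighborFinset w v).2 hw.symm)
  have h4 := Finset.card_le_two (a := u) (b := w)
  simp only [card_neighborFinset_eq_degree] at h3
  omega

namespace IsCritical

variable {k : ℕ}

theorem not_leaf (hG : G.IsCritical k) {v u : V} (hu : G.Adj v u)
    (h : ∀ z, G.Adj v z → z = u) : False := by
  have h1 := hG.lt_degree_square v u u hu hu fun z hz => Or.inl (h z hz)
  have h2 := degree_square_add_one_le (fun z hz => Or.inl (h z hz)) {u} hu.symm (w := u) (by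
    rintro x - (rfl | rfl | h | h) <;> simp_all)
  have h3 := hG.degree_le u
  simp only [Finset.card_singleton] at h2
  omega

/-- If `a` sees nothing outside the interval, an empty edge makes `a` a leaf, an ear has its tip's
square neighbors in the closed neighborhood of `b`, and a heavy edge contradicts `leftCount ≤ 3`. -/
theorem Config.not_free_left (hG : G.IsCritical k) {a b : V} (h : Config G k a b)
    (hf : ∀ z, G.Adj a z → a < z ∧ z ≤ b) : False := by
  rcases h with h | ⟨p, h⟩ | h
  · exact hG.not_leaf h.1 fun z hz => h.left hz (hf z hz).1 (hf z hz).2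
  · have hN := fun z (hz : G.Adj p z) => h.mid hG.not_crossing hz
    have h1 := hG.lt_degree_square p a b h.adj_left.symm h.adj_right hN
    have h2 := degree_square_add_one_le hN {b} h.adj_right.symm (by
      rintro x hx (rfl | rfl | h' | h')
      · right; exact h.1.symm
      · left; simp
      · rcases h.left h' (hf x h').1 (hf x h').2 with rfl | rfl
        · exact absurd rfl hx
        · left; simp
      · right; exact h')
    have h3 := hG.degree_le b
    simp only [Finset.card_singleton] at h2
    omega
  · have h1 : G.leftCount a b = G.degree a := by
      rw [leftCount, Finset.filter_true_of_mem, card_neighborFinset_eq_degree]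
      exact fun z hz => hf z (by simpa using hz)
    have := hG.six_le
    obtain ⟨h2, -, h3⟩ := h
    omega

theorem Config.not_free_right (hG : G.IsCritical k) {a b : V} (h : Config G k a b)
    (hf : ∀ z, G.Adj b z → a ≤ z ∧ z < b) : False := by
  rcases h with h | ⟨p, h⟩ | h
  · exact hG.not_leaf h.1.symm fun z hz => h.right hz (hf z hz).1 (hf z hz).2
  · have hN := fun z (hz : G.Adj p z) => h.mid hG.not_crossing hz
    have h1 := hG.lt_degree_square p a b h.adj_left.symm h.adj_right hN
    have h2 := degree_square_add_one_le hN {a} h.adj_left (by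
      rintro x hx (rfl | rfl | h' | h')
      · left; simp
      · right; exact h.1
      · right; exact h'
      · rcases h.right h' (hf x h').1 (hf x h').2 with rfl | rfl
        · left; simp
        · exact absurd rfl hx)
    have h3 := hG.degree_le a
    simp only [Finset.card_singleton] at h2
    omega
  · have h1 : G.rightCount a b = G.degree b := by
      rw [rightCount, Finset.filter_true_of_mem, card_neighborFinset_eq_degree]
      exact fun z hz => hf z (by simpa using hz)
    have := hG.six_le
    obtain ⟨-, h2, h3⟩ := h
    omega

/-- The edge `ab` belongs to the chain of outermost edges below the edge `xy`, and `b` is not the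
last vertex of this chain. -/
structure IsLink (G : SimpleGraph V) [DecidableRel G.Adj] (k : ℕ) (x y a b : V) : Prop where
  adj : G.Adj a b
  le : x ≤ a
  lt : a < b
  lt' : b < y
  config : Config G k a b
  left : ∀ z, G.Adj b z → z < b → a ≤ z
  cut : ∀ z c, G.Adj z c → x ≤ z → z < b → b < c → c ≤ y → z = x ∧ c = y

/-- The edge `bc` follows the edge `ab` in a chain. -/
structure IsNext (G : SimpleGraph V) [DecidableRel G.Adj] (a b c : V) : Prop where
  adj : G.Adj b c
  lt : b < c
  left : ∀ z, G.Adj b z → z < b → a ≤ z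
  right : ∀ z, G.Adj b z → z ≤ c
  degree_eq : G.degree b = G.rightCount a b + G.leftCount b c
  config_left : G.IsEmptyEdge a b ∨ ∃ p, G.IsEar a p b
  config_right : G.IsEmptyEdge b c ∨ ∃ p, G.IsEar b p c

/-- The vertex `b` has a neighbor to its right by `Config.not_free_right`, and the farthest one
stays below `xy`. All neighbors of `b` then lie between `a` and `c`. -/
theorem IsLink.exists_next (hG : G.IsCritical k) {x y a b : V} (hxy : G.Adj x y)
    (ih : ∀ a b, x ≤ a → a < b → b ≤ y → ¬ (a = x ∧ b = y) → G.Adj a b → Config G k a b)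
    (h : IsLink G k x y a b) : ∃ c, IsNext G a b c ∧ (c = y ∨ IsLink G k x y b c) := by
  have hxb : x < b := h.le.trans_lt h.lt
  obtain ⟨z, hz, hbz⟩ : ∃ z, G.Adj b z ∧ b < z := by
    by_contra! hno
    refine h.config.not_free_right hG fun z hz => ?_
    have hzb : z < b := lt_of_le_of_ne (hno z hz) hz.ne'
    exact ⟨h.left z hz hzb, hzb⟩
  have hne : (G.neighborFinset b).Nonempty := ⟨z, by simpa using hz⟩
  set c := (G.neighborFinset b).max' hne with hc
  have hcb : G.Adj b c := by simpa using (G.neighborFinset b).max'_mem hne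
  have hmax : ∀ z, G.Adj b z → z ≤ c := fun z hz => Finset.le_max' _ z (by simpa using hz)
  have hbc : b < c := hbz.trans_le (hmax z hz)
  have hcy : c ≤ y := by
    by_contra! hcy
    exact hG.not_crossing x y b c hxy hcb hxb h.lt' hcy
  have hT : Config G k b c := ih b c hxb.le hbc hcy (fun e => hxb.ne' e.1) hcb
  have hdeg := degree_eq h.left hmax
  have h6 := hG.six_le
  have h3 := h.config.rightCount_le
  have h3' := hT.leftCount_le
  refine ⟨c, ⟨hcb, hbc, h.left, hmax, hdeg, ?_, ?_⟩, ?_⟩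
  · rcases h.config with h' | h' | h'
    · exact Or.inl h'
    · exact Or.inr h'
    · exfalso
      -- For `k ≥ 7`, a heavy edge needs degree `k` at `b`, or `k - 1` with at most two left
      -- neighbors, but only `3 + 3` or `2 + 3` neighbors are available. If all degrees are below
      -- `k`, no edge is heavy.
      obtain ⟨-, -, h'⟩ := h'
      rcases hG.seven_le_or with h7 | h7
      · omega
      · have := h7 a
        have := h7 b
        omega
  · rcases hT with h' | h' | h'
    · exact Or.inl h'
    · exact Or.inr h'
    · exfalso
      obtain ⟨-, -, h'⟩ := h'
      rcases hG.seven_le_or with h7 | h7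
      · omega
      · have := h7 b
        have := h7 c
        omega
  · rcases eq_or_lt_of_le hcy with e | hcy
    · exact Or.inl e
    · refine Or.inr ⟨hcb, hxb.le, hbc, hcy, hT, ?_, ?_⟩
      · intro z hz hzc
        by_contra! hzb
        have hxz : x ≤ z := by
          by_contra! hzx
          exact hG.not_crossing z c x y hz.symm hxy hzx (hxb.trans hbc) hcy
        exact hcy.ne (h.cut z c hz.symm hxz hzb hbc hcy.le).2
      · intro z d hzd hxz hzc hcd hdy
        rcases lt_trichotomy z b with hzb | rfl | hzb
        · exact h.cut z d hzd hxz hzb (hbc.trans hcd) hdy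
        · exact absurd (hmax d hzd) (not_le.2 hcd)
        · exact (hG.not_crossing b c z d hcb hzd hzb hzc hcd).elim

/-- If the leftmost vertex with a rightward edge below `xy` were not `x`, the edge to its last
neighbor would contradict `Config.not_free_left`. -/
theorem exists_first_link (hG : G.IsCritical k) {x y : V} (hxy : G.Adj x y) (hlt : x < y)
    (ih : ∀ a b, x ≤ a → a < b → b ≤ y → ¬ (a = x ∧ b = y) → G.Adj a b → Config G k a b)
    (hE : ¬ G.IsEmptyEdge x y) : ∃ q, IsLink G k x y x q ∧ ∀ z, G.Adj x z → x < z → z < y → z ≤ q := by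
  obtain ⟨v, hxv, hv, hvy⟩ : ∃ v, G.Adj x v ∧ x < v ∧ v < y := by
    set s : Finset V := Finset.univ.filter fun u => x ≤ u ∧ ∃ v, u < v ∧ v ≤ y ∧ G.Adj u v ∧
      ¬ (u = x ∧ v = y) with hs
    have hsne : s.Nonempty := by
      by_contra hno
      rw [Finset.not_nonempty_iff_eq_empty] at hno
      refine hE ⟨hxy, hlt, fun u v huv h1 h2 h3 => ?_⟩
      by_contra h4
      have : u ∈ s := by simp only [hs, Finset.mem_filter]; exact ⟨by simp, h1, v, h2, h3, huv, h4⟩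
      simp [hno] at this
    obtain ⟨a, ha, hmin⟩ : ∃ a ∈ s, ∀ u ∈ s, a ≤ u :=
      ⟨s.min' hsne, s.min'_mem hsne, fun u hu => s.min'_le u hu⟩
    simp only [hs, Finset.mem_filter, Finset.mem_univ, true_and] at ha hmin
    obtain ⟨hxa, v, hav, hvy, hadj, hne⟩ := ha
    rcases eq_or_lt_of_le hxa with rfl | hxa
    · exact ⟨v, hadj, hav, lt_of_le_of_ne hvy fun e => hne ⟨rfl, e⟩⟩
    · exfalso
      have hay : a < y := hav.trans_le hvy
      have hne : (G.neighborFinset a).Nonempty := ⟨v, by simpa using hadj⟩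
      set b := (G.neighborFinset a).max' hne with hb
      have hab : G.Adj a b := by simpa using (G.neighborFinset a).max'_mem hne
      have hmax : ∀ z, G.Adj a z → z ≤ b := fun z hz => Finset.le_max' _ z (by simpa using hz)
      have hlab : a < b := hav.trans_le (hmax v hadj)
      have hby : b ≤ y := by
        by_contra! hcy
        exact hG.not_crossing x y a b hxy hab hxa hay hcy
      refine (ih a b hxa.le hlab hby (fun e => hxa.ne' e.1) hab).not_free_left hG fun z hz => ?_
      refine ⟨?_, hmax z hz⟩
      by_contra! hza
      have hza : z < a := lt_of_le_of_ne hza hz.ne'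
      have hxz : x ≤ z := by
        by_contra! hzx
        exact hG.not_crossing z a x y hz.symm hxy hzx hxa hay
      exact absurd (hmin z ⟨hxz, a, hza, hay.le, hz.symm, fun e => hay.ne e.2⟩) (not_le.2 hza)
  have hne : ((G.neighborFinset x).filter fun z => x < z ∧ z < y).Nonempty :=
    ⟨v, by simp [hxv, hv, hvy]⟩
  obtain ⟨hq, hmax⟩ : ∃ q, (G.Adj x q ∧ x < q ∧ q < y) ∧
      ∀ z, G.Adj x z → x < z → z < y → z ≤ q := by
    refine ⟨Finset.max' _ hne, by simpa using Finset.max'_mem _ hne, fun z h1 h2 h3 => ?_⟩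
    exact Finset.le_max' _ z (by simp [h1, h2, h3])
  obtain ⟨⟨hxq, hlq, hqy⟩, hmax⟩ := hmax
  refine ⟨_, ⟨hxq, le_rfl, hlq, hqy, ih _ _ le_rfl hlq hqy.le (fun e => hqy.ne e.2) hxq, ?_, ?_⟩,
    hmax⟩
  · intro z hz hzq
    by_contra! hzx
    exact hG.not_crossing z _ x y hz.symm hxy hzx hlq hqy
  · intro z c hzc hxz hzq hqc hcy
    rcases eq_or_lt_of_le hxz with rfl | hxz
    · refine ⟨rfl, hcy.antisymm ?_⟩
      by_contra! hcy'
      exact absurd (hmax c hzc (hlq.trans hqc) hcy') (not_le.2 hqc)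
    · exact (hG.not_crossing x _ z c hxq hzc hxz hzq hqc).elim

end IsCritical

end SimpleGraph

/-! ### Chains of outermost edges, and the contradiction -/

namespace SimpleGraph.IsCritical

variable {V : Type*} [LinearOrder V] [Fintype V] {G : SimpleGraph V} [DecidableRel G.Adj]

theorem IsNext.rightCount_le {a b c : V} (h : IsNext G a b c) : G.rightCount a b ≤ 2 := by
  rcases h.config_left with h' | ⟨p, h'⟩
  · exact h'.rightCount_le.trans (by omega)
  · exact h'.rightCount_le

theorem IsNext.leftCount_le {a b c : V} (h : IsNext G a b c) : G.leftCount b c ≤ 2 := by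
  rcases h.config_right with h' | ⟨p, h'⟩
  · exact h'.leftCount_le.trans (by omega)
  · exact h'.leftCount_le

theorem IsNext.left_or_right {a b c z : V} (h : IsNext G a b c) (hz : G.Adj b z) :
    (a ≤ z ∧ z < b) ∨ (b < z ∧ z ≤ c) := by
  rcases lt_or_gt_of_ne hz.ne with h' | h'
  · exact Or.inr ⟨h', h.right z hz⟩
  · exact Or.inl ⟨h.left z hz h', h'⟩

theorem leftCount_le_add_one {x y q : V}
    (h : ∀ z, G.Adj x z → x < z → z < y → z ≤ q) : G.leftCount x y ≤ G.leftCount x q + 1 := by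
  refine (Finset.card_le_card (t := insert y ((G.neighborFinset x).filter fun z => x < z ∧ z ≤ q))
    fun z hz => ?_).trans (Finset.card_insert_le _ _)
  simp only [Finset.mem_filter, mem_neighborFinset, Finset.mem_insert] at hz ⊢
  rcases eq_or_lt_of_le hz.2.2 with h' | h'
  · exact Or.inl h'
  · exact Or.inr ⟨hz.1, hz.2.1, h z hz.1 hz.2.1 h'⟩

theorem IsLink.rightCount_le_add_one {k : ℕ} {x y a q : V} (h : IsLink G k x y a q) :
    G.rightCount x y ≤ G.rightCount q y + 1 := by
  refine (Finset.card_le_card (t := insert x ((G.neighborFinset y).filter fun z => q ≤ z ∧ z < y))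
    fun z hz => ?_).trans (Finset.card_insert_le _ _)
  simp only [Finset.mem_filter, mem_neighborFinset, Finset.mem_insert] at hz ⊢
  rcases lt_or_ge z q with h' | h'
  · exact Or.inl (h.cut z y hz.1.symm hz.2.1 h' h.lt' le_rfl).1
  · exact Or.inr ⟨hz.1, h', hz.2.2⟩

variable [DecidableRel G.square.Adj] {k : ℕ}

/-- Inner chain vertices have degree at most four, so the tip of an ear on `bc` would have at most
`4 + 4 - 2 = 6 ≤ k` square neighbors. -/
theorem isEmptyEdge_of_isNext (hG : G.IsCritical k) {a b c d : V} (h : IsNext G a b c)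
    (h' : IsNext G b c d) : G.IsEmptyEdge b c := by
  rcases h.config_right with hE | ⟨p, hp⟩
  · exact hE
  · exfalso
    have hN := fun z (hz : G.Adj p z) => hp.mid hG.not_crossing hz
    have h1 := hG.lt_degree_square p b c hp.adj_left.symm hp.adj_right hN
    have h2 := degree_square_add_two_le hp.adj_left.symm hp.adj_right hN hp.1
    have := h.degree_eq
    have := h'.degree_eq
    have := h.rightCount_le
    have := h'.rightCount_le
    have := h.leftCount_le
    have := h'.leftCount_le
    have := hG.six_le
    omega

theorem le_degree_left_of_isEar (hG : G.IsCritical k) {x p q c : V} (hp : G.IsEar x p q)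
    (h : IsNext G x q c) (T : Finset V) (hx : x ∈ T)
    (hT : ∀ z, G.Adj q z → q < z → z ∈ T ∨ G.Adj x z) : k + 2 ≤ T.card + G.degree x := by
  have hN := fun z (hz : G.Adj p z) => hp.mid hG.not_crossing hz
  have h1 := hG.lt_degree_square p x q hp.adj_left.symm hp.adj_right hN
  have h2 := degree_square_add_one_le hN T hp.adj_left (by
    rintro z hz (rfl | rfl | h' | h')
    · exact Or.inl hx
    · exact Or.inr hp.1
    · exact Or.inr h'
    · rcases h.left_or_right h' with h'' | h''
      · rcases hp.right h' h''.1 h''.2 with rfl | rfl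
        · exact Or.inl hx
        · exact absurd rfl hz
      · exact hT z h' h''.1)
  omega

theorem le_degree_right_of_isEar (hG : G.IsCritical k) {a q p y : V} (hp : G.IsEar q p y)
    (h : IsNext G a q y) (T : Finset V) (hy : y ∈ T)
    (hT : ∀ z, G.Adj q z → z < q → z ∈ T ∨ G.Adj y z) : k + 2 ≤ T.card + G.degree y := by
  have hN := fun z (hz : G.Adj p z) => hp.mid hG.not_crossing hz
  have h1 := hG.lt_degree_square p q y hp.adj_left.symm hp.adj_right hN
  have h2 := degree_square_add_one_le hN T hp.adj_right.symm (by
    rintro z hz (rfl | rfl | h' | h')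
    · exact Or.inr hp.1.symm
    · exact Or.inl hy
    · rcases h.left_or_right h' with h'' | h''
      · exact hT z h' h''.2
      · rcases hp.left h' h''.1 h''.2 with rfl | rfl
        · exact absurd rfl hz
        · exact Or.inl hy
    · exact Or.inr h')
  omega

theorem config_of_two_edges (hG : G.IsCritical k) {x y q : V} (hxy : G.Adj x y)
    (h : IsNext G x q y) (hL : G.leftCount x y ≤ G.leftCount x q + 1)
    (hR : G.rightCount x y ≤ G.rightCount q y + 1)
    (hcut : ∀ u v, G.Adj u v → x ≤ u → u < v → v ≤ y → (u = x ∧ v = y) ∨ v ≤ q ∨ q ≤ u) :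
    Config G k x y := by
  have hdx := hG.degree_le x
  have hdy := hG.degree_le y
  rcases h.config_left with hE | ⟨p, hp⟩ <;> rcases h.config_right with hE' | ⟨p', hp'⟩
  · exact Or.inr (Or.inl ⟨q, hxy, hE, hE', hcut⟩)
  · have := le_degree_right_of_isEar hG hp' h {y} (by simp) (fun z hz hzq => Or.inr (by
      rw [hE.right hz (h.left z hz hzq) hzq]; exact hxy.symm))
    simp only [Finset.card_singleton] at this
    omega
  · have := le_degree_left_of_isEar hG hp h {x} (by simp) (fun z hz hzq => Or.inr (by
      rw [hE'.left hz hzq (h.right z hz)]; exact hxy))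
    simp only [Finset.card_singleton] at this
    omega
  · have h1 := le_degree_right_of_isEar hG hp' h {y, p} (by simp) (fun z hz hzq => by
      rcases hp.right hz (h.left z hz hzq) hzq with rfl | rfl
      · exact Or.inr hxy.symm
      · simp)
    have h2 := le_degree_left_of_isEar hG hp h {x, p'} (by simp) (fun z hz hzq => by
      rcases hp'.left hz hzq (h.right z hz) with rfl | rfl
      · simp
      · exact Or.inr hxy)
    have h3 := Finset.card_le_two (a := x) (b := p')
    have h4 := Finset.card_le_two (a := y) (b := p)
    have h5 := hp.leftCount_le
    have h6 := hp'.rightCount_le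
    exact Or.inr (Or.inr ⟨by omega, by omega, Or.inl ⟨by omega, by omega⟩⟩)

/-- If `xq` is empty, `q` has two neighbors, and its square neighbors not adjacent to `x` are among
`x`, `r` and the tip of an ear on `ry`; such a tip costs one degree. If `xq` is an ear, its tip
plays the role of `q`, and no such loss occurs. -/
theorem le_degree_left_of_three_edges (hG : G.IsCritical k) {x y q r : V} (hxy : G.Adj x y)
    (h : IsNext G x q r) (h' : IsNext G q r y) (hqr : G.IsEmptyEdge q r) :
    k ≤ G.degree x + 1 ∧ ((G.IsEmptyEdge r y ∨ ∃ p, G.IsEar x p q) → k ≤ G.degree x) := by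
  have hr : ∀ z, G.Adj q z → q < z → z = r := fun z hz hqz => hqr.left hz hqz (h.right z hz)
  have hq : ∀ z, G.Adj r z → z < r → z = q := fun z hz hzr => hqr.right hz (h'.left z hz hzr) hzr
  have h2 := Finset.card_le_two (a := x) (b := r)
  rcases h.config_left with hE | ⟨p, hp⟩
  · have hN : ∀ z, G.Adj q z → z = x ∨ z = r := by
      intro z hz
      rcases h.left_or_right hz with h1 | h1
      · exact Or.inl (hE.right hz h1.1 h1.2)
      · exact Or.inr (hr z hz h1.1)
    have hk := hG.lt_degree_square q x r hE.1.symm h.adj hN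
    have hdeg : ∀ T : Finset V, x ∈ T → r ∈ T → (∀ z, G.Adj r z → r < z → z ∈ T ∨ z = y) →
        k + 2 ≤ T.card + G.degree x := by
      intro T hx hrT hT
      have := degree_square_add_one_le hN T hE.1 (by
        rintro z hz (rfl | rfl | h1 | h1)
        · exact Or.inl hx
        · exact Or.inl hrT
        · exact Or.inr h1
        · rcases h'.left_or_right h1 with h3 | h3
          · exact absurd (hq z h1 h3.2) hz
          · rcases hT z h1 h3.1 with h4 | rfl
            · exact Or.inl h4
            · exact Or.inr hxy)
      omega
    rcases h'.config_right with hE' | ⟨p', hp'⟩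
    · have := hdeg {x, r} (by simp) (by simp) fun z hz hrz =>
        Or.inr (hE'.left hz hrz (h'.right z hz))
      exact ⟨by omega, fun _ => by omega⟩
    · have := hdeg {x, r, p'} (by simp) (by simp) fun z hz hrz => by
        rcases hp'.left hz hrz (h'.right z hz) with rfl | rfl <;> simp
      have h3 := Finset.card_le_three (a := x) (b := r) (c := p')
      refine ⟨by omega, ?_⟩
      rintro (hE' | ⟨p, hp⟩)
      · have := hE'.left hp'.adj_left hp'.lt_left hp'.lt_right.le
        exact absurd this hp'.lt_right.ne
      · have := hE.left hp.adj_left hp.lt_left hp.lt_right.le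
        exact absurd this hp.lt_right.ne
  · have := le_degree_left_of_isEar hG hp h {x, r} (by simp) fun z hz hqz => by
      simp [hr z hz hqz]
    exact ⟨by omega, fun _ => by omega⟩

theorem le_degree_right_of_three_edges (hG : G.IsCritical k) {x y q r : V} (hxy : G.Adj x y)
    (h : IsNext G x q r) (h' : IsNext G q r y) (hqr : G.IsEmptyEdge q r) :
    k ≤ G.degree y + 1 ∧ ((G.IsEmptyEdge x q ∨ ∃ p, G.IsEar r p y) → k ≤ G.degree y) := by
  have hr : ∀ z, G.Adj q z → q < z → z = r := fun z hz hqz => hqr.left hz hqz (h.right z hz)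
  have hq : ∀ z, G.Adj r z → z < r → z = q := fun z hz hzr => hqr.right hz (h'.left z hz hzr) hzr
  have h2 := Finset.card_le_two (a := y) (b := q)
  rcases h'.config_right with hE | ⟨p, hp⟩
  · have hN : ∀ z, G.Adj r z → z = q ∨ z = y := by
      intro z hz
      rcases h'.left_or_right hz with h1 | h1
      · exact Or.inl (hq z hz h1.2)
      · exact Or.inr (hE.left hz h1.1 h1.2)
    have hk := hG.lt_degree_square r q y h.adj.symm h'.adj hN
    have hdeg : ∀ T : Finset V, y ∈ T → q ∈ T → (∀ z, G.Adj q z → z < q → z ∈ T ∨ z = x) →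
        k + 2 ≤ T.card + G.degree y := by
      intro T hy hqT hT
      have := degree_square_add_one_le hN T hE.1.symm (by
        rintro z hz (rfl | rfl | h1 | h1)
        · exact Or.inl hqT
        · exact Or.inl hy
        · rcases h.left_or_right h1 with h3 | h3
          · rcases hT z h1 h3.2 with h4 | rfl
            · exact Or.inl h4
            · exact Or.inr hxy.symm
          · exact absurd (hr z h1 h3.1) hz
        · exact Or.inr h1)
      omega
    rcases h.config_left with hE' | ⟨p', hp'⟩
    · have := hdeg {y, q} (by simp) (by simp) fun z hz hzq =>
        Or.inr (hE'.right hz (h.left z hz hzq) hzq)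
      exact ⟨by omega, fun _ => by omega⟩
    · have := hdeg {y, q, p'} (by simp) (by simp) fun z hz hzq => by
        rcases hp'.right hz (h.left z hz hzq) hzq with rfl | rfl <;> simp
      have h3 := Finset.card_le_three (a := y) (b := q) (c := p')
      refine ⟨by omega, ?_⟩
      rintro (hE' | ⟨p, hp⟩)
      · have := hE'.left hp'.adj_left hp'.lt_left hp'.lt_right.le
        exact absurd this hp'.lt_right.ne
      · have := hE.left hp.adj_left hp.lt_left hp.lt_right.le
        exact absurd this hp.lt_right.ne
  · have := le_degree_right_of_isEar hG hp h' {y, q} (by simp) fun z hz hzr => by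
      simp [hq z hz hzr]
    exact ⟨by omega, fun _ => by omega⟩

theorem config_of_three_edges (hG : G.IsCritical k) {x y q r : V} (hxy : G.Adj x y)
    (h : IsNext G x q r) (h' : IsNext G q r y) (hL : G.leftCount x y ≤ G.leftCount x q + 1)
    (hR : G.rightCount x y ≤ G.rightCount r y + 1) : Config G k x y := by
  have hqr := isEmptyEdge_of_isNext hG h h'
  obtain ⟨h1, h2⟩ := le_degree_left_of_three_edges hG hxy h h' hqr
  obtain ⟨h3, h4⟩ := le_degree_right_of_three_edges hG hxy h h' hqr
  refine Or.inr (Or.inr ?_)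
  rcases h.config_left with hE | ⟨p, hp⟩ <;> rcases h'.config_right with hE' | ⟨p', hp'⟩
  · have := hE.leftCount_le
    have := hE'.rightCount_le
    exact ⟨by omega, by omega, Or.inl ⟨h2 (Or.inl hE'), h4 (Or.inl hE)⟩⟩
  · have := hE.leftCount_le
    have := hp'.rightCount_le
    exact ⟨by omega, by omega, Or.inr (Or.inr ⟨h4 (Or.inl hE), h1, by omega⟩)⟩
  · have := hp.leftCount_le
    have := hE'.rightCount_le
    exact ⟨by omega, by omega, Or.inr (Or.inl ⟨h2 (Or.inl hE'), h3, by omega⟩)⟩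
  · have := hp.leftCount_le
    have := hp'.rightCount_le
    exact ⟨by omega, by omega, Or.inl ⟨h2 (Or.inr ⟨p, hp⟩), h4 (Or.inr ⟨p', hp'⟩)⟩⟩

/-- Both edges at `r` are empty, so `q` and `s` have degree at most three and `r` at most six square
neighbors. -/
theorem not_four_edges (hG : G.IsCritical k) {x q r s d : V} (h : IsNext G x q r)
    (h' : IsNext G q r s) (h'' : IsNext G r s d) : False := by
  have hqr := isEmptyEdge_of_isNext hG h h'
  have hrs := isEmptyEdge_of_isNext hG h' h''
  have hN : ∀ z, G.Adj r z → z = q ∨ z = s := by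
    intro z hz
    rcases h'.left_or_right hz with h1 | h1
    · exact Or.inl (hqr.right hz h1.1 h1.2)
    · exact Or.inr (hrs.left hz h1.1 h1.2)
  have h1 := hG.lt_degree_square r q s hqr.1.symm hrs.1 hN
  have h2 := degree_square_le hqr.1.symm hrs.1 hN
  have := h.degree_eq
  have := h''.degree_eq
  have := h.rightCount_le
  have := h''.leftCount_le
  have := hqr.leftCount_le
  have := hrs.rightCount_le
  have := hG.six_le
  omega

theorem config_of_forall (hG : G.IsCritical k) {x y : V} (hxy : G.Adj x y) (hlt : x < y)
    (ih : ∀ a b, x ≤ a → a < b → b ≤ y → ¬ (a = x ∧ b = y) → G.Adj a b → Config G k a b) :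
    Config G k x y := by
  by_cases hE : G.IsEmptyEdge x y
  · exact Or.inl hE
  obtain ⟨q, hq, hqmax⟩ := exists_first_link hG hxy hlt ih hE
  have hL := leftCount_le_add_one hqmax
  obtain ⟨r, hr, rfl | hr'⟩ := hq.exists_next hG hxy ih
  · refine config_of_two_edges hG hxy hr hL hq.rightCount_le_add_one fun u v huv h1 h2 h3 => ?_
    by_contra! hno
    exact (hno.1 (hq.cut u v huv h1 hno.2.2 hno.2.1 h3).1) (hq.cut u v huv h1 hno.2.2 hno.2.1 h3).2
  obtain ⟨s, hs, rfl | hs'⟩ := hr'.exists_next hG hxy ih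
  · exact config_of_three_edges hG hxy hr hs hL hr'.rightCount_le_add_one
  obtain ⟨d, hd, -⟩ := hs'.exists_next hG hxy ih
  exact (not_four_edges hG hr hs hd).elim

theorem config (hG : G.IsCritical k) {x y : V} (hxy : G.Adj x y) (hlt : x < y) :
    Config G k x y := by
  induction hn : (Finset.univ.filter fun z => x ≤ z ∧ z ≤ y).card using Nat.strong_induction_on
    generalizing x y with
  | _ n ih =>
    refine config_of_forall hG hxy hlt fun a b hxa hab hby hne hadj => ih _ ?_ hadj hab rfl
    rw [← hn]
    refine Finset.card_lt_card ((Finset.ssubset_iff_of_subset ?_).2 ?_)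
    · intro z hz
      simp only [Finset.mem_filter, Finset.mem_univ, true_and] at hz ⊢
      exact ⟨hxa.trans hz.1, hz.2.trans hby⟩
    · rcases eq_or_lt_of_le hxa with rfl | hxa
      · exact ⟨y, by simp [hlt.le], by
          have : b < y := lt_of_le_of_ne hby fun e => hne ⟨rfl, e⟩
          simp [this]⟩
      · exact ⟨x, by simp [hlt.le], by simp [hxa]⟩

/-- A critical graph has no edges. -/
theorem not_adj (hG : G.IsCritical k) (a b : V) : ¬ G.Adj a b := by
  intro hab
  have hs : (Finset.univ.filter fun x => ∃ y, G.Adj x y).Nonempty := ⟨a, by simp; exact ⟨b, hab⟩⟩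
  obtain ⟨x, hx, hmin⟩ : ∃ x, (∃ y, G.Adj x y) ∧ ∀ z, (∃ y, G.Adj z y) → x ≤ z := by
    refine ⟨Finset.min' _ hs, by simpa using Finset.min'_mem _ hs, fun z hz => ?_⟩
    exact Finset.min'_le _ z (by simpa using hz)
  obtain ⟨y, hy⟩ := hx
  have hne : (G.neighborFinset x).Nonempty := ⟨y, by simpa using hy⟩
  have hxm : G.Adj x ((G.neighborFinset x).max' hne) := by
    simpa using (G.neighborFinset x).max'_mem hne
  have hlt : ∀ z, G.Adj x z → x < z := fun z hz =>
    lt_of_le_of_ne (hmin z ⟨x, hz.symm⟩) hz.ne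
  -- All neighbors of the first nonisolated vertex lie between it and its last neighbor.
  exact (hG.config hxm (hlt _ hxm)).not_free_left hG fun z hz =>
    ⟨hlt z hz, Finset.le_max' _ z (by simpa using hz)⟩

end SimpleGraph.IsCritical

/-! ### Degeneracy of the square -/

namespace SimpleGraph

variable {V : Type*}

/-- An edge that crosses `uw` also crosses `vu` or `vw`, wherever `v` lies. -/
theorem IsNoncrossing.bypass {G : SimpleGraph V} {f : V → ℤ} (hf : G.IsNoncrossing f) {v u w : V}
    (hu : G.Adj v u) (hw : G.Adj v w) : (G.bypass v u w).IsNoncrossing f := by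
  have pair : ∀ {p q}, (G.bypass v u w).Adj p q → G.Adj p q ∨ (G.Adj v p ∧ G.Adj v q) := by
    rintro p q ⟨-, -, -, h | ⟨rfl, rfl⟩ | ⟨rfl, rfl⟩⟩
    · exact Or.inl h
    · exact Or.inr ⟨hu, hw⟩
    · exact Or.inr ⟨hw, hu⟩
  have ends : ∀ {p q}, (G.bypass v u w).Adj p q → ¬ G.Adj p q →
      (p = u ∧ q = w) ∨ (p = w ∧ q = u) := by
    rintro p q ⟨-, -, -, h | h⟩ h'
    · exact absurd h h'
    · exact h
  refine ⟨hf.injective, fun a b c d hab hcd h1 h2 h3 => ?_⟩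
  have hva : f v ≠ f a := fun e => hab.1 (hf.injective e).symm
  have hvb : f v ≠ f b := fun e => hab.2.1 (hf.injective e).symm
  have hvc : f v ≠ f c := fun e => hcd.1 (hf.injective e).symm
  have hvd : f v ≠ f d := fun e => hcd.2.1 (hf.injective e).symm
  by_cases hab' : G.Adj a b
  · by_cases hcd' : G.Adj c d
    · exact hf.not_crossing a b c d hab' hcd' h1 h2 h3
    · obtain ⟨hc, hd⟩ := (pair hcd).resolve_left hcd'
      by_cases hv1 : f v < f a
      · exact hf.not_crossing v c a b hc hab' hv1 h1 h2
      by_cases hv2 : f v < f b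
      · exact hf.not_crossing a b v d hab' hd (by omega) hv2 h3
      · exact hf.not_crossing a b c v hab' hc.symm h1 h2 (by omega)
  · by_cases hcd' : G.Adj c d
    · obtain ⟨ha, hb⟩ := (pair hab).resolve_left hab'
      by_cases hv1 : f v < f c
      · exact hf.not_crossing v b c d hb hcd' hv1 h2 h3
      by_cases hv2 : f v < f d
      · exact hf.not_crossing a v c d ha.symm hcd' h1 (by omega) hv2
      · exact hf.not_crossing c d b v hcd' hb.symm h2 h3 (by omega)
    · rcases ends hab hab' with ⟨rfl, rfl⟩ | ⟨rfl, rfl⟩ <;>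
      rcases ends hcd hcd' with ⟨rfl, rfl⟩ | ⟨rfl, rfl⟩ <;> omega

-- The vertices `u` and `w` lose the neighbor `v` and gain at most each other.
open Classical in
theorem degree_bypass_le [Fintype V] {G : SimpleGraph V} {v u w : V} (hu : G.Adj v u)
    (hw : G.Adj v w) (p : V) : (G.bypass v u w).degree p ≤ G.degree p := by
  have swap : ∀ a b, G.Adj v a → (∀ q, (G.bypass v u w).Adj a q → q ≠ v ∧ (G.Adj a q ∨ q = b)) →
      (G.bypass v u w).degree a ≤ G.degree a := by
    intro a b ha h
    have h1 : (G.bypass v u w).neighborFinset a ⊆ insert b ((G.neighborFinset a).erase v) := by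
      intro q hq
      obtain ⟨hqv, hq'⟩ := h q (by simpa using hq)
      rcases hq' with hq' | hq'
      · simp [hqv, hq']
      · simp [hq']
    have h2 := (Finset.card_le_card h1).trans (Finset.card_insert_le _ _)
    have h3 := Finset.card_erase_add_one ((G.mem_neighborFinset a v).2 ha.symm)
    simp only [card_neighborFinset_eq_degree] at h2 h3
    omega
  by_cases h1 : p = u
  · subst h1
    refine swap p w hu fun q hq => ⟨hq.2.1, ?_⟩
    rcases hq.2.2.2 with h | h | h
    · exact Or.inl h
    · exact Or.inr h.2
    · exact absurd h.2.symm hq.2.2.1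
  by_cases h2 : p = w
  · subst h2
    refine swap p u hw fun q hq => ⟨hq.2.1, ?_⟩
    rcases hq.2.2.2 with h | h | h
    · exact Or.inl h
    · exact absurd h.2.symm hq.2.2.1
    · exact Or.inr h.2
  · rw [← card_neighborFinset_eq_degree, ← card_neighborFinset_eq_degree]
    refine Finset.card_le_card fun q hq => ?_
    rw [mem_neighborFinset] at hq ⊢
    rcases hq.2.2.2 with h | h | h
    · exact h
    · exact absurd h.1 h1
    · exact absurd h.1 h2

theorem square_bypass {G : SimpleGraph V} {v u w x y : V}
    (hv : ∀ z, G.Adj v z → z = u ∨ z = w) (hx : x ≠ v) (hy : y ≠ v) (h : G.square.Adj x y) :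
    (G.bypass v u w).square.Adj x y := by
  refine ⟨h.1, ?_⟩
  rcases h.2 with h' | ⟨z, hxz, hyz⟩
  · exact Or.inl ⟨hx, hy, h.1, Or.inl h'⟩
  · by_cases hz : z = v
    · subst hz
      refine Or.inl ⟨hx, hy, h.1, Or.inr ?_⟩
      rcases hv x hxz.symm with rfl | rfl <;> rcases hv y hyz.symm with rfl | rfl
      · exact absurd rfl h.1
      · exact Or.inl ⟨rfl, rfl⟩
      · exact Or.inr ⟨rfl, rfl⟩
      · exact absurd rfl h.1
    · exact Or.inr ⟨z, ⟨hx, hz, hxz.ne, Or.inl hxz⟩, hy, hz, hyz.ne, Or.inl hyz⟩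

open Classical in
/-- A noncrossing graph with an edge has a vertex with one or two neighbors which has few neighbors
in the square. -/
theorem IsNoncrossing.exists_degree_square_le [Fintype V] {G : SimpleGraph V} {f : V → ℤ}
    (hf : G.IsNoncrossing f) {k : ℕ} (h6 : 6 ≤ k) (hd : ∀ v, G.degree v ≤ k)
    (h7 : 7 ≤ k ∨ ∀ v, G.degree v < k) (hE : ∃ a b, G.Adj a b) :
    ∃ v u w, G.Adj v u ∧ G.Adj v w ∧ (∀ z, G.Adj v z → z = u ∨ z = w) ∧
      G.square.degree v ≤ k := by
  by_contra! hno
  let : LinearOrder V := LinearOrder.lift' f hf.injective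
  have hG : G.IsCritical k := ⟨hf.not_crossing, h6, hd, h7, hno⟩
  obtain ⟨a, b, hab⟩ := hE
  exact hG.not_adj a b hab

open Classical in
/-- The square of a noncrossing graph is `k`-degenerate. -/
theorem IsNoncrossing.exists_card_filter_square_le [Fintype V] {G : SimpleGraph V} {f : V → ℤ}
    (hf : G.IsNoncrossing f) {k : ℕ} (h6 : 6 ≤ k) (hd : ∀ v, G.degree v ≤ k)
    (h7 : 7 ≤ k ∨ ∀ v, G.degree v < k) {S : Finset V} (hS : S.Nonempty) :
    ∃ v ∈ S, (S.filter fun x => G.square.Adj v x).card ≤ k := by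
  induction hn : {x | ∃ y, G.Adj x y}.ncard using Nat.strong_induction_on generalizing G with
  | _ n ih =>
    obtain ⟨s, hs⟩ := hS
    by_cases hE : ∃ a b, G.Adj a b
    swap
    · push Not at hE
      refine ⟨s, hs, ?_⟩
      rw [Finset.filter_false_of_mem]
      · simp
      · rintro x - ⟨-, h | ⟨z, h, -⟩⟩ <;> exact hE _ _ h
    obtain ⟨v, u, w, hu, hw, hv, hk⟩ := hf.exists_degree_square_le h6 hd h7 hE
    by_cases hvS : v ∈ S
    · refine ⟨v, hvS, le_trans ?_ hk⟩
      rw [← card_neighborFinset_eq_degree]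
      exact Finset.card_le_card fun x hx => by simpa using (Finset.mem_filter.1 hx).2
    -- Contracting at `v ∉ S` loses no square adjacency inside `S`, because a path of length two
    -- through `v` becomes the edge `uw`.
    · have hdeg := degree_bypass_le hu hw
      obtain ⟨x, hx, hxk⟩ := ih _ (by
        rw [← hn]
        refine Set.ncard_lt_ncard ?_ (Set.toFinite _)
        refine (Set.ssubset_iff_of_subset ?_).2 ⟨v, ⟨u, hu⟩, fun ⟨y, hy⟩ => hy.1 rfl⟩
        rintro x ⟨y, -, -, -, h | ⟨rfl, -⟩ | ⟨rfl, -⟩⟩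
        · exact ⟨y, h⟩
        · exact ⟨v, hu.symm⟩
        · exact ⟨v, hw.symm⟩) (hf.bypass hu hw) (fun p => (hdeg p).trans (hd p))
        (h7.imp_right fun h p => (hdeg p).trans_lt (h p)) rfl
      refine ⟨x, hx, le_trans (Finset.card_le_card fun y hy => ?_) hxk⟩
      rw [Finset.mem_filter] at hy ⊢
      exact ⟨hy.1, square_bypass hv (fun e => hvS (e ▸ hx)) (fun e => hvS (e ▸ hy.1)) hy.2⟩

open Classical in
theorem inductiveness_le [Fintype V] {H : SimpleGraph V} {k : ℕ}
    (h : ∀ S : Finset V, S.Nonempty → ∃ v ∈ S, (S.filter fun x => H.Adj v x).card ≤ k) :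
    H.inductiveness ≤ k := by
  refine Finset.sup_le fun s _ => ?_
  rcases s.eq_empty_or_nonempty with rfl | hs
  · have : IsEmpty ((∅ : Finset V) : Set V) := by simp
    simp
  · obtain ⟨v, hv, hk⟩ := h s hs
    refine (minDegree_le_degree _ ⟨v, hv⟩).trans (le_trans ?_ hk)
    rw [← card_neighborFinset_eq_degree]
    refine Finset.card_le_card_of_injOn Subtype.val ?_ Subtype.val_injective.injOn
    intro x hx
    have : H.Adj v x := by simpa using hx
    simp [this]

open Classical in
theorem degree_le_inductiveness_square [Fintype V] (G : SimpleGraph V) (v : V) :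
    G.degree v ≤ G.square.inductiveness := by
  set s : Finset V := insert v (G.neighborFinset v) with hs
  have hcard : s.card = G.degree v + 1 := by
    rw [hs, Finset.card_insert_of_notMem (by simp), card_neighborFinset_eq_degree]
  have hclique : ∀ x ∈ s, ∀ y ∈ s, x ≠ y → G.square.Adj x y := by
    intro x hx y hy hxy
    simp only [hs, Finset.mem_insert, mem_neighborFinset] at hx hy
    refine ⟨hxy, ?_⟩
    rcases hx with rfl | hx <;> rcases hy with rfl | hy
    · exact absurd rfl hxy
    · exact Or.inl hy
    · exact Or.inl hx.symm
    · exact Or.inr ⟨v, hx.symm, hy.symm⟩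
  have : Nonempty ((s : Finset V) : Set V) := ⟨⟨v, by simp [hs]⟩⟩
  refine le_trans ?_ (Finset.le_sup (f := fun s : Finset V =>
    (G.square.induce (s : Set V)).minDegree) (Finset.mem_univ s))
  refine le_minDegree_of_forall_le_degree _ _ fun p => ?_
  have h1 : s.erase p ⊆
      ((G.square.induce (s : Set V)).neighborFinset p).map (Function.Embedding.subtype _) := by
    intro x hx
    obtain ⟨hxp, hxs⟩ := Finset.mem_erase.1 hx
    refine Finset.mem_map.2 ⟨⟨x, hxs⟩, ?_, rfl⟩
    rw [mem_neighborFinset]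
    exact hclique p p.2 x hxs hxp.symm
  have h2 := Finset.card_le_card h1
  rw [Finset.card_map, card_neighborFinset_eq_degree] at h2
  have h3 := Finset.card_erase_add_one (show (p : V) ∈ s from p.2)
  omega

end SimpleGraph

theorem theorem1 {V : Type*} [Fintype V] (G : SimpleGraph V) [DecidableRel G.Adj]
    (hG : G.IsOuterplanar) :
    (5 ≤ G.maxDegree → G.square.inductiveness ≤ G.maxDegree + 1) ∧
      (7 ≤ G.maxDegree → G.square.inductiveness = G.maxDegree) := by
  classical
  obtain ⟨f, hf⟩ := hG.exists_isNoncrossing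
  have hd : ∀ v (_ : Fintype (G.neighborSet v)), G.degree v ≤ G.maxDegree := fun v _ => by
    convert G.degree_le_maxDegree v
  constructor
  · intro h5
    refine SimpleGraph.inductiveness_le fun S hS => ?_
    convert hf.exists_card_filter_square_le (k := G.maxDegree + 1) (by omega)
      (fun v => ?_) (Or.inr fun v => ?_) hS
    · exact (hd v _).trans (Nat.le_succ _)
    · exact Nat.lt_succ_of_le (hd v _)
  · intro h7
    refine le_antisymm (SimpleGraph.inductiveness_le fun S hS => ?_) ?_
    · convert hf.exists_card_filter_square_le (k := G.maxDegree) (by omega)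
        (fun v => ?_) (Or.inl h7) hS
      exact hd v _
    · refine G.maxDegree_le_of_forall_degree_le _ fun v => ?_
      convert G.degree_le_inductiveness_square v
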